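/- **Setting.** Let $d\ge 1$, let $p$ be a bounded probability density on $\mathbb{R}^d$ and $\mu$ the measure with density $p$. Write $L(s)=\overline{\{x : p(x)\ge s\}}$. Fix a level $t>0$ and assume that $L(t)$ has finitely many connected components $C^{(1)},\dots,C^{(m)}$ (the clusters), that each is compact, and that each is a domain with smooth boundary whose principal curvatures are at most $1/\kappa^{(i)}$, $\kappa^{(i)}>0$. Let $C_-^{(i)}(\varepsilon)$ be the connected component of $L(t-\varepsilon)$ that contains $C^{(i)}$. Let $\tilde\varepsilon>0$, $u^{(i)}>0$ and $\rho^{(i)}>0$ be such that $\operatorname{dist}(C_-^{(i)}(2\tilde\varepsilon),C_-^{(j)}(2\tilde\varepsilon))\ge u^{(i)}$ for $j\ne i$, and $\rho^{(i)}\le \mu(B(x,u^{(i)}))$ for all $x\in C_-^{(i)}(2\tilde\varepsilon)$. Put $\beta_{(i)}=\mu(C^{(i)})$, $\tilde\beta_{(i)}=\mu(C_-^{(i)}(2\tilde\varepsilon))$, $p^{(i)}_{\max}=\sup_{C^{(i)}}p$, and let $\eta_d$ be the volume of the unit ball. With $Col^{(i)}(r)=\{x\in C^{(i)}: \operatorname{dist}(x,\partial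 C^{(i)})\le r\}$, let $\nu^{(i)}_{\max}$ be the supremum of the $\nu\in(0,\kappa^{(i)}]$ such that for all $r\in(0,\nu]$ the set $C^{(i)}\setminus Col^{(i)}(r)$ is non-empty and connected and every point of $C^{(i)}$ has distance at most $r$ to it ($\nu^{(i)}_{\max}=0$ if there is no such $\nu$). **Graphs.** Let $X_1,\dots,X_n$ be i.i.d. from $\mu$. In the mutual $k$-nearest-neighbor graph $G_{\mathrm{mut}}(n,k)$, $X_a$ and $X_b$ are adjacent if each is among the $k$ nearest neighbors of the other. For a density estimate $\hat p_n$, the graph $\tilde G_{\mathrm{mut}}(n,k,t',\delta)$ is obtained from it by deleting all vertices with $\hat p_n(X_a)<t'$ and then all connected components with fewer than $\delta n$ vertices. $C^{(i)}$ is *identified* in $G_{\mathrm{mut}}$ if all sample points in $C^{(i)}$ are connected to each other (by paths) and to no sample point of another cluster. It is *roughly identified* in $\tilde G_{\mathrm{mut}}$ if all sample points in $C^{(i)}$ are vertices of $\tilde G_{\mathrm{mut}}$, they are connected to each other there and to no point of another cluster, and every connected component of $\tilde G_{\mathrm{mut}}$ contains a point of some cluster. **Condition 1** (for $n$ and a real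 number $k$): $$4^{d+1}\tfrac{p^{(i)}_{\max}}{t}\log\!\big(2\cdot 8^d p^{(i)}_{\max}\operatorname{vol}(C^{(i)})\,n\big)\le k\le (n-1)\min\Big\{\tfrac{\rho^{(i)}}2-\tfrac{2\log(\tilde\beta_{(i)}n)}{n},\;2\cdot4^d\eta_d\,p^{(i)}_{\max}\min\{u^{(i)},\nu^{(i)}_{\max}\}^d\Big\}.$$ **Condition 2** (for $\delta,\varepsilon>0$): $p$ is three times continuously differentiable with uniformly bounded derivatives, $\beta_{(i)}>2\delta$, $\varepsilon\le\tilde\varepsilon$, $L(t-2\varepsilon)=\bigcup_j C_-^{(j)}(2\varepsilon)$, and $\mu\big(\bigcup_j (C_-^{(j)}(2\varepsilon)\setminus C^{(j)})\big)\le\delta/2$. **Theorem.** Put $$\Gamma^{(i)}=\frac{\rho^{(i)}}{2+\frac1{4^d}\frac{t}{p^{(i)}_{\max}}},\qquad k^*_n=(n-1)\Gamma^{(i)}+1,\qquad \Omega^{(i)}_{\mathrm{noisefree}}=\frac{\rho^{(i)}}{2\cdot4^{d+1}\frac{p^{(i)}_{\max}}{t}+4},$$ $$I_n(k)=\tfrac{n-1}{2}\Big(\tfrac{\rho^{(i)}}2-\tfrac{k-1}{n-1}\Big),\qquad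 A(k)=\tfrac{k-1}{4^{d+1}}\tfrac{t}{p^{(i)}_{\max}}.$$ 1. *(Optimal $k$.)* For every $n\ge2$, $I_n(k^*_n)=A(k^*_n)=(n-1)\Omega^{(i)}_{\mathrm{noisefree}}$, and $k^*_n$ is the unique maximizer of $\min\{I_n(k),A(k)\}$ over $k\in\mathbb{R}$. 2. *(Noise-free case.)* Assume that $p=0$ outside $L(t)$ and $p\ge t$ almost everywhere on $L(t)$. Then for all sufficiently large $n$: for every integer $k$ satisfying Condition 1, $$\mathrm P\big(C^{(i)}\text{ is identified in }G_{\mathrm{mut}}(n,k)\big)\ge1-\big(e^{-I_n(k)}+2e^{-A(k)}\big);$$ and if $k^*_n$ satisfies Condition 1, then for every integer $k$ with $|k-k^*_n|<1$ (that is, $k=k^*_n$ up to rounding), $$\mathrm P\big(C^{(i)}\text{ is identified in }G_{\mathrm{mut}}(n,k)\big)\ge1-3e^{-(n-1)\Omega^{(i)}_{\mathrm{noisefree}}}.$$ 3. *(Noisy case.)* Let $p$ be three times continuously differentiable with uniformly bounded derivatives and let $K$ be a bounded symmetric probability density on $\mathbb{R}^d$ with finite second moment. There are constants $C_1,C_2>0$,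 depending only on $p$ and $K$, such that the following holds for all choices of the level, the clusters and the constants above, all $i$, all $\delta,\varepsilon>0$ satisfying Condition 2, and all $h>0$ with $h^2\le C_1\varepsilon$. Let $\hat p_n(x)=\frac1{nh^d}\sum_l K((x-X_l)/h)$ and $$\Omega^{(i)}_{\mathrm{noisy}}=\min\Big\{\Omega^{(i)}_{\mathrm{noisefree}},\;\tfrac n{n-1}\tfrac\delta8,\;\tfrac n{n-1}C_2h^d\varepsilon^2\Big\}.$$ For every $n\ge2$, $k^*_n$ maximizes $\min\{I_n(k),A(k),n\delta/8,C_2nh^d\varepsilon^2\}$ over $k\in\mathbb{R}$, with maximum $(n-1)\Omega^{(i)}_{\mathrm{noisy}}$. For all sufficiently large $n$: for every integer $k$ satisfying Condition 1, the probability that $C^{(i)}$ is roughly identified in $\tilde G_{\mathrm{mut}}(n,k,t-\varepsilon,\delta)$ is at least $$1-\big(e^{-I_n(k)}+2e^{-A(k)}+2e^{-n\delta/8}+3e^{-C_2nh^d\varepsilon^2}\big);$$ and if $k^*_n$ satisfies Condition 1, then for every integer $k$ with $|k-k^*_n|<1$ this probability is at least $1-8e^{-(n-1)\Omega^{(i)}_{\mathrm{noisy}}}$.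 -/

import Mathlib

open MeasureTheory
open scoped ContDiff

/-- `ℝ^d` with the Euclidean distance. -/
abbrev Euc (d : ℕ) : Type := EuclideanSpace ℝ (Fin d)

/-- `η_d`, the volume of the `d`-dimensional unit ball. -/
noncomputable def unitBallVolume (d : ℕ) : ℝ := volume.real (Metric.ball (0 : Euc d) 1)

/-! ### Density and level sets -/

/-- `p` is a bounded probability density with respect to Lebesgue measure. -/
structure IsBoundedDensity {d : ℕ} (p : Euc d → ℝ) : Prop where
  measurable : Measurable p
  nonneg : ∀ x, 0 ≤ p x
  bounded : ∃ B : ℝ, ∀ x, p x ≤ B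
  mass_one : ∫⁻ x, ENNReal.ofReal (p x) = 1

/-- The measure `μ` with density `p`. -/
noncomputable def densityMeasure {d : ℕ} (p : Euc d → ℝ) : Measure (Euc d) :=
  volume.withDensity fun x => ENNReal.ofReal (p x)

/-- The law of `n` i.i.d. sample points `X_1, …, X_n` from `μ`. -/
noncomputable def sampleLaw {d : ℕ} (p : Euc d → ℝ) (n : ℕ) : Measure (Fin n → Euc d) :=
  Measure.pi fun _ => densityMeasure p

/-- The `s`-level set `L(s)`: the closure of `{x | p x ≥ s}`. -/
def levelSet {d : ℕ} (p : Euc d → ℝ) (s : ℝ) : Set (Euc d) := closure {x | s ≤ p x}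

/-- The connected component of `L(s)` that contains the connected set `A ⊆ L(s)`. -/
def levelComponent {d : ℕ} (p : Euc d → ℝ) (s : ℝ) (A : Set (Euc d)) : Set (Euc d) :=
  ⋃ x ∈ A, connectedComponentIn (levelSet p s) x

/-! ### Geometry of a cluster -/

/-- The boundary of `A` is a smooth `(d-1)`-dimensional submanifold: near each boundary point, `A`
is the sublevel set `{φ ≤ 0}` of a smooth function `φ` with non-zero differential there.
Every principal curvature of the boundary, that is every value of the second fundamental form
`D²φ(v, v) / ‖Dφ‖` on unit tangent vectors `v`, is at most `1 / κ` (the sign is such that a ball of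
radius `r` has principal curvatures `1 / r`); so `κ` is (a positive lower bound on)
the minimal curvature radius. -/
def HasSmoothBoundary {d : ℕ} (A : Set (Euc d)) (κ : ℝ) : Prop :=
  ∀ x ∈ frontier A, ∃ (U : Set (Euc d)) (φ : Euc d → ℝ),
    IsOpen U ∧ x ∈ U ∧ ContDiff ℝ ∞ φ ∧ φ x = 0 ∧ fderiv ℝ φ x ≠ 0 ∧
    (∀ y ∈ U, y ∈ A ↔ φ y ≤ 0) ∧
    ∀ v : Euc d, fderiv ℝ φ x v = 0 →
      κ * iteratedFDeriv ℝ 2 φ x ![v, v] ≤ ‖fderiv ℝ φ x‖ * ‖v‖ ^ 2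

/-- The collar set `Col(ν) = {x ∈ A | dist(x, ∂A) ≤ ν}`. -/
def collar {d : ℕ} (A : Set (Euc d)) (ν : ℝ) : Set (Euc d) :=
  {x | x ∈ A ∧ Metric.infDist x (frontier A) ≤ ν}

/-- The maximal covering radius `ν_max`: the supremum of the radii `ν ≤ κ` such that, for all radii
`r` up to `ν`, the inner part `A \ Col(r)` is connected and each point of `A` has distance at
most `r` to it. (The latter says that balls of radius `r` inside `A` reach every
point of `A`; for a cluster without bottlenecks it follows from `r < κ`.) -/
noncomputable def maxCoveringRadius {d : ℕ} (A : Set (Euc d)) (κ : ℝ) : ℝ :=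
  sSup {ν | 0 < ν ∧ ν ≤ κ ∧ ∀ r, 0 < r → r ≤ ν →
    IsConnected (A \ collar A r) ∧ ∀ x ∈ A, Metric.infDist x (A \ collar A r) ≤ r}

/-! ### The cluster model -/

/-- The level `t`, the clusters and the geometric constants attached to them, with the standing
assumptions on them. -/
structure ClusterModel {d : ℕ} (p : Euc d → ℝ) where
  /-- the level -/
  t : ℝ
  t_pos : 0 < t
  /-- the number of clusters -/
  m : ℕ
  /-- the clusters: exactly the connected components of `L(t)`, without repetition -/
  C : Fin m → Set (Euc d)
  C_injective : Function.Injective C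
  C_range : Set.range C = {A | ∃ x ∈ levelSet p t, A = connectedComponentIn (levelSet p t) x}
  C_compact : ∀ i, IsCompact (C i)
  /-- the minimal curvature radii -/
  κ : Fin m → ℝ
  κ_pos : ∀ i, 0 < κ i
  C_smooth : ∀ i, HasSmoothBoundary (C i) (κ i)
  /-- the parameter `ε̃` -/
  εtilde : ℝ
  εtilde_pos : 0 < εtilde
  /-- the lower bounds on the distances between the clusters -/
  u : Fin m → ℝ
  u_pos : ∀ i, 0 < u i
  u_le_dist : ∀ i j, i ≠ j →
    ∀ x ∈ levelComponent p (t - 2 * εtilde) (C i),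
    ∀ y ∈ levelComponent p (t - 2 * εtilde) (C j), u i ≤ dist x y
  /-- the lower bounds on the probability of balls of radius `u` -/
  ρ : Fin m → ℝ
  ρ_pos : ∀ i, 0 < ρ i
  ρ_le : ∀ i, ∀ x ∈ levelComponent p (t - 2 * εtilde) (C i),
    ρ i ≤ (densityMeasure p).real (Metric.ball x (u i))

namespace ClusterModel

variable {d : ℕ} {p : Euc d → ℝ} (S : ClusterModel p) (i : Fin S.m)

/-- `C_-^{(i)}(ε)`, the connected component of `L(t - ε)` containing the `i`-th cluster. -/
def Cminus (ε : ℝ) : Set (Euc d) := levelComponent p (S.t - ε) (S.C i)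

/-- `β_(i)`, the probability mass of the `i`-th cluster. -/
noncomputable def β : ℝ := (densityMeasure p).real (S.C i)

/-- The probability mass of `C_-^{(i)}(2 ε̃)`. -/
noncomputable def βtilde : ℝ := (densityMeasure p).real (S.Cminus i (2 * S.εtilde))

/-- The maximal density in the `i`-th cluster. -/
noncomputable def pmax : ℝ := sSup (p '' S.C i)

/-- The maximal covering radius of the `i`-th cluster. -/
noncomputable def νmax : ℝ := maxCoveringRadius (S.C i) (S.κ i)

/-- `Γ^{(i)}`. -/
noncomputable def Γ : ℝ := S.ρ i / (2 + 1 / 4 ^ d * (S.t / S.pmax i))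

/-- The real number `(n - 1) Γ^{(i)} + 1`. -/
noncomputable def kOpt (n : ℕ) : ℝ := ((n : ℝ) - 1) * S.Γ i + 1

/-- The rate in the noise-free case. -/
noncomputable def ΩnoiseFree : ℝ := S.ρ i / (2 * 4 ^ (d + 1) * (S.pmax i / S.t) + 4)

/-- The rate in the noisy case, where `c` stands for the constant `C₂`. -/
noncomputable def Ωnoisy (n : ℕ) (c δ h ε : ℝ) : ℝ :=
  min (S.ΩnoiseFree i)
    (min ((n : ℝ) / ((n : ℝ) - 1) * (δ / 8)) ((n : ℝ) / ((n : ℝ) - 1) * (c * h ^ d * ε ^ 2)))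

/-- The exponent of the bound for the event that the cluster is not isolated from the others. -/
noncomputable def betweenExponent (n : ℕ) (k : ℝ) : ℝ :=
  ((n : ℝ) - 1) / 2 * (S.ρ i / 2 - (k - 1) / ((n : ℝ) - 1))

/-- The exponent of the bound for the event that the cluster is not connected. -/
noncomputable def withinExponent (_n : ℕ) (k : ℝ) : ℝ :=
  (k - 1) / 4 ^ (d + 1) * (S.t / S.pmax i)

/-- The worst exponent in the noise-free case. -/
noncomputable def worstExponent (n : ℕ) (k : ℝ) : ℝ :=
  min (S.betweenExponent i n k) (S.withinExponent i n k)

/-- The worst exponent in the noisy case. -/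
noncomputable def worstExponentNoisy (n : ℕ) (c δ h ε k : ℝ) : ℝ :=
  min (S.worstExponent i n k) (min (n * (δ / 8)) (c * n * h ^ d * ε ^ 2))

/-- Condition 1: lower and upper bounds on the number of neighbors. -/
def Condition1 (n : ℕ) (k : ℝ) : Prop :=
  4 ^ (d + 1) * (S.pmax i / S.t) *
      Real.log (2 * 8 ^ d * S.pmax i * volume.real (S.C i) * n) ≤ k ∧
  k ≤ ((n : ℝ) - 1) *
      min (S.ρ i / 2 - 2 * Real.log (S.βtilde i * n) / n)
        (2 * 4 ^ d * unitBallVolume d * S.pmax i * min (S.u i) (S.νmax i) ^ d)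

/-- Condition 2 without the smoothness of the density: `β_(i) > 2 δ` and `ε` is small enough. -/
structure Condition2 (δ ε : ℝ) : Prop where
  δ_pos : 0 < δ
  ε_pos : 0 < ε
  two_mul_δ_lt : 2 * δ < S.β i
  ε_le : ε ≤ S.εtilde
  /-- no component of `L(t - 2ε)` is disjoint from all clusters -/
  cover : levelSet p (S.t - 2 * ε) ⊆ ⋃ j, S.Cminus j (2 * ε)
  boundary_mass : (densityMeasure p).real (⋃ j, S.Cminus j (2 * ε) \ S.C j) ≤ δ / 2

/-- The noise-free case: the density is bounded below by `t` on the clusters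
and vanishes outside of them. -/
def NoiseFree : Prop :=
  (∀ᵐ x, x ∈ levelSet p S.t → S.t ≤ p x) ∧ ∀ x, x ∉ levelSet p S.t → p x = 0

end ClusterModel

/-- The density is three times continuously differentiable with uniformly bounded derivatives. -/
def IsSmoothDensity {d : ℕ} (p : Euc d → ℝ) : Prop :=
  ContDiff ℝ 3 p ∧ ∃ B : ℝ, ∀ l ≤ 3, ∀ x, ‖iteratedFDeriv ℝ l p x‖ ≤ B

/-! ### Kernel density estimation -/

/-- A standard kernel: a bounded symmetric probability density with finite second moment. -/
structure IsKernel {d : ℕ} (K : Euc d → ℝ) : Prop where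
  measurable : Measurable K
  nonneg : ∀ x, 0 ≤ K x
  bounded : ∃ B : ℝ, ∀ x, K x ≤ B
  symmetric : ∀ x, K (-x) = K x
  integral_one : ∫ x, K x = 1
  second_moment : Integrable fun x => ‖x‖ ^ 2 * K x

/-- The kernel density estimator with kernel `K` and bandwidth `h` for the sample `X`. -/
noncomputable def kernelEstimator {d n : ℕ} (K : Euc d → ℝ) (h : ℝ) (X : Fin n → Euc d)
    (y : Euc d) : ℝ :=
  1 / (n * h ^ d) * ∑ l, K (h⁻¹ • (y - X l))

/-! ### The graphs -/

/-- `X_b` is among the `k` nearest neighbors of `X_a` in the sample without `X_a`: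
fewer than `k` sample points other than `X_a` are strictly closer to `X_a` than `X_b` is
(ties have probability zero for samples from a density). -/
def IsNearestNeighbor {d n : ℕ} (X : Fin n → Euc d) (k : ℕ) (a b : Fin n) : Prop :=
  b ≠ a ∧ {l : Fin n | l ≠ a ∧ dist (X l) (X a) < dist (X b) (X a)}.ncard < k

/-- The mutual `k`-nearest-neighbor graph on the sample. -/
def mutualKNN {d n : ℕ} (X : Fin n → Euc d) (k : ℕ) : SimpleGraph (Fin n) where
  Adj a b := IsNearestNeighbor X k a b ∧ IsNearestNeighbor X k b a
  symm := ⟨fun _ _ h => ⟨h.2, h.1⟩⟩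
  loopless := ⟨fun _ h => h.1.1 rfl⟩

/-- The vertices with estimated density at least `s`; the others are removed. -/
def denseVertices {d n : ℕ} (X : Fin n → Euc d) (phat : Euc d → ℝ) (s : ℝ) : Set (Fin n) :=
  {a | s ≤ phat (X a)}

/-- The vertices that remain after the sample points with estimated density below `s` and then the
connected components with less than `δ n` points have been removed from the graph `G`. -/
def remainingVertices {d n : ℕ} (X : Fin n → Euc d) (phat : Euc d → ℝ) (G : SimpleGraph (Fin n))
    (s δ : ℝ) : Set (Fin n) :=
  {a | ∃ ha : a ∈ denseVertices X phat s,
    δ * n ≤ ((((G.induce (denseVertices X phat s)).connectedComponentMk ⟨a, ha⟩).supp.ncard : ℕ) : ℝ)}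

namespace ClusterModel

variable {d : ℕ} {p : Euc d → ℝ} (S : ClusterModel p) (i : Fin S.m)

/-- The `i`-th cluster is identified in the graph `G` on the sample `X`: its sample points are
connected to each other, and not to points of any other cluster. -/
def Identified {n : ℕ} (X : Fin n → Euc d) (G : SimpleGraph (Fin n)) : Prop :=
  (∀ a b, X a ∈ S.C i → X b ∈ S.C i → G.Reachable a b) ∧
  ∀ a b, X a ∈ S.C i → ∀ j, j ≠ i → X b ∈ S.C j → ¬ G.Reachable a b

/-- The `i`-th cluster is roughly identified in the subgraph of `G` that is induced on the
remaining vertices `V`: all its sample points remain, they are connected to each other in the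
subgraph, they are not connected there to points of another cluster, and no connected component of
the subgraph consists of background points only. -/
def RoughlyIdentified {n : ℕ} (X : Fin n → Euc d) (G : SimpleGraph (Fin n)) (V : Set (Fin n)) :
    Prop :=
  (∀ a, X a ∈ S.C i → a ∈ V) ∧
  (∀ a b : V, X a ∈ S.C i → X b ∈ S.C i → (G.induce V).Reachable a b) ∧
  (∀ a b : V, X a ∈ S.C i → ∀ j, j ≠ i → X b ∈ S.C j → ¬ (G.induce V).Reachable a b) ∧
  ∀ a : V, ∃ b : V, (G.induce V).Reachable a b ∧ ∃ j, X b ∈ S.C j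

/-- The probability that the `i`-th cluster is identified in the mutual
`k`-nearest-neighbor graph on `n` sample points. -/
noncomputable def probIdentified (n k : ℕ) : ℝ :=
  (sampleLaw p n).real {X | S.Identified i X (mutualKNN X k)}

/-- The probability that the `i`-th cluster is roughly identified in the reduced mutual
`k`-nearest-neighbor graph on `n` sample points with parameters `t - ε` and `δ`, with the kernel
density estimator with kernel `K` and bandwidth `h`. -/
noncomputable def probRoughlyIdentified (K : Euc d → ℝ) (h ε δ : ℝ) (n k : ℕ) : ℝ :=
  (sampleLaw p n).real {X | S.RoughlyIdentified i X (mutualKNN X k)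
    (remainingVertices X (kernelEstimator K h X) (mutualKNN X k) (S.t - ε) δ)}

end ClusterModel

open scoped ENNReal

/-! ### Exponential moment bounds for i.i.d. samples -/

/-! Identification can fail in two ways only, and each failure lies in an event about counts of
sample points in balls, which Chernoff's bound controls.

Separation. If a sample point has at least `k` others within distance `u`, all its edges in the
mutual graph are shorter than `u`. When all vertices lie in the sets `C_-^{(j)}(2ε̃)`, a path from
one cluster to another has an edge of length at least `u`. So only a point of `C_-^{(i)}(2ε̃)` with
fewer than `k` others in its `u`-ball is dangerous, while the expected count there is at least
`(n-1)ρ` (`exists_between_event`).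

Connectedness. Choose `r` with `pmax * η_d * (4r)^d = (k-1) / (2(n-1))`. A `4r`-ball about a cluster
point then contains at most `(k-1)/2` other points on average, so typically all cluster points
closer than `4r` are adjacent. Also, each ball of an `r`-net of the inner part `C \ Col(r)`
typically contains a sample point. As the inner part is connected and comes within `r` of all of
`C`, the cluster points are linked (`reachable_of_net`, `exists_within_event`).

Noise. The kernel estimator has bias of order `h²` and exponentially small deviations, so
thresholding at `t - ε` keeps the cluster points and only points of `L(t-2ε)`
(`exists_density_event`). The cluster has more than `δn` sample points and the background in
`L(t-2ε)` fewer (`exists_count_event`); hence deleting small components keeps the cluster and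
removes all pure background components.

Rounding and union bounds. The graph events are bounded for an integer `k` by the exponents at a
real `K` with `|k - K| < 1`; `K = k` and `K = k*` give the two stated bounds. For large `n`,
Condition 1 forces `K ≥ 8 log n`, which absorbs the factor `n` of the union bounds and the rounding.
The two exponents are affine in `k` with slopes of opposite sign, so their minimum peaks where they
cross. -/

/-- Independence: the integral of a product of functions of the separate coordinates. -/
theorem lintegral_pi_prod {E : Type*} [MeasurableSpace E] (μ : Measure E) [SigmaFinite μ]
    {g : E → ℝ≥0∞} (hg : Measurable g) (n : ℕ) :
    ∫⁻ X : Fin n → E, ∏ l, g (X l) ∂(Measure.pi fun _ => μ) = (∫⁻ y, g y ∂μ) ^ n := by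
  induction n with
  | zero => simp
  | succ m ih =>
    have h := ((measurePreserving_piFinSuccAbove (fun _ : Fin (m + 1) => μ) 0).symm)
    rw [← h.lintegral_comp (by fun_prop)]
    simp only [MeasurableEquiv.piFinSuccAbove_symm_apply, Fin.insertNthEquiv,
      Equiv.coe_fn_mk, Fin.prod_univ_succAbove _ 0, Fin.insertNth_apply_same,
      Fin.insertNth_apply_succAbove]
    rw [lintegral_prod _ (by fun_prop)]
    have : ∀ x : E, ∫⁻ Y : Fin m → E, g x * ∏ l, g (Y l) ∂(Measure.pi fun _ => μ) =
        g x * (∫⁻ y, g y ∂μ) ^ m := fun x => by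
      rw [lintegral_const_mul _ (by fun_prop), ih]
    simp only [this]
    rw [lintegral_mul_const _ hg, pow_succ']

/-- Fubini with `X a` split off: given `X a = x`, the other coordinates are still i.i.d., so their
factors integrate to a power. -/
theorem lintegral_pi_pair_prod {E : Type*} [MeasurableSpace E] (μ : Measure E) [SigmaFinite μ]
    {F : E → ℝ≥0∞} (hF : Measurable F) {g : E → E → ℝ≥0∞}
    (hg : Measurable (Function.uncurry g)) {m : ℕ} (a : Fin (m + 1)) :
    ∫⁻ X : Fin (m + 1) → E, F (X a) * ∏ l, g (X a) (X (a.succAbove l)) ∂(Measure.pi fun _ => μ) =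
      ∫⁻ x, F x * (∫⁻ y, g x y ∂μ) ^ m ∂μ := by
  have h := ((measurePreserving_piFinSuccAbove (fun _ : Fin (m + 1) => μ) a).symm)
  have hg' : ∀ x, Measurable (g x) := fun x => hg.of_uncurry_left
  have hg2 : ∀ l : Fin m, Measurable fun X : E × (Fin m → E) => g X.1 (X.2 l) := fun l =>
    hg.comp (measurable_fst.prodMk ((measurable_pi_apply l).comp measurable_snd))
  have hg3 : ∀ l : Fin m, Measurable fun X : (Fin (m + 1) → E) =>
      g (X a) (X (a.succAbove l)) := fun l => by
    have h2 : Measurable fun X : (Fin (m + 1) → E) => (X a, X (a.succAbove l)) :=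
      (measurable_pi_apply _).prodMk (measurable_pi_apply _)
    exact hg.comp h2
  rw [← h.lintegral_comp (by fun_prop)]
  simp only [MeasurableEquiv.piFinSuccAbove_symm_apply, Fin.insertNthEquiv,
    Equiv.coe_fn_mk, Fin.insertNth_apply_same,
    Fin.insertNth_apply_succAbove]
  rw [lintegral_prod _ (by fun_prop)]
  refine lintegral_congr fun x => ?_
  have := hg' x
  dsimp only
  rw [lintegral_const_mul _ (by fun_prop), lintegral_pi_prod μ (hg' x)]

/-- Chernoff's bound for a sum of i.i.d. terms. -/
theorem measureReal_pi_le_exp {E : Type*} [MeasurableSpace E] (μ : Measure E)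
    [IsProbabilityMeasure μ] {φ : E → ℝ} (hφ : Measurable φ) {s : ℝ}
    (hs : ∫⁻ y, ENNReal.ofReal (Real.exp (φ y)) ∂μ ≤ ENNReal.ofReal (Real.exp s)) (n : ℕ) (τ : ℝ) :
    (Measure.pi fun _ : Fin n => μ).real {X | τ ≤ ∑ l, φ (X l)} ≤ Real.exp (n * s - τ) := by
  refine ENNReal.toReal_le_of_le_ofReal (Real.exp_nonneg _) ?_
  have hsub : {X : Fin n → E | τ ≤ ∑ l, φ (X l)} ⊆
      {X | ENNReal.ofReal (Real.exp τ) ≤ ∏ l, ENNReal.ofReal (Real.exp (φ (X l)))} := by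
    intro X hX
    simp only [Set.mem_ofPred_eq] at hX ⊢
    rw [← ENNReal.ofReal_prod_of_nonneg fun _ _ => Real.exp_nonneg _, ← Real.exp_sum]
    exact ENNReal.ofReal_le_ofReal (Real.exp_le_exp.2 hX)
  refine (measure_mono hsub).trans ?_
  have hm := mul_meas_ge_le_lintegral (μ := Measure.pi fun _ : Fin n => μ)
    (f := fun X => ∏ l, ENNReal.ofReal (Real.exp (φ (X l)))) (by fun_prop)
    (ENNReal.ofReal (Real.exp τ))
  rw [lintegral_pi_prod μ (g := fun y => ENNReal.ofReal (Real.exp (φ y))) (by fun_prop)] at hm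
  have hm2 := hm.trans (pow_le_pow_left' hs n)
  rw [Real.exp_sub, ENNReal.ofReal_div_of_pos (Real.exp_pos _),
    ENNReal.le_div_iff_mul_le (by simp [Real.exp_pos]) (by simp), mul_comm, Real.exp_nat_mul,
    ENNReal.ofReal_pow (Real.exp_nonneg _)]
  exact hm2

/-- Chernoff's bound, conditionally on one of the sample points, for the other points. -/
theorem measureReal_pi_exists_le_exp {E : Type*} [MeasurableSpace E] (μ : Measure E)
    [IsProbabilityMeasure μ] {φ : E → E → ℝ} (hφ : Measurable (Function.uncurry φ)) {s : ℝ}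
    {A : Set E} (hs : ∀ x ∈ A, ∫⁻ y, ENNReal.ofReal (Real.exp (φ x y)) ∂μ ≤
      ENNReal.ofReal (Real.exp s)) (m : ℕ) (τ : ℝ) :
    (Measure.pi fun _ : Fin (m + 1) => μ).real
      {X | ∃ a, X a ∈ A ∧ τ ≤ ∑ l, φ (X a) (X (a.succAbove l))} ≤
      (m + 1) * Real.exp (m * s - τ) := by
  set g : E → E → ℝ≥0∞ := fun x y => ENNReal.ofReal (Real.exp (φ x y)) with hg
  have hgm : Measurable (Function.uncurry g) :=
    (Real.measurable_exp.comp hφ).ennreal_ofReal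
  have hint : Measurable fun x => ∫⁻ y, g x y ∂μ := hgm.lintegral_prod_right'
  -- `A` need not be measurable (it will be a component of a level set). It is enlarged to the
  -- measurable set of all points where the moment bound holds.
  set A' : Set E := {x | ∫⁻ y, g x y ∂μ ≤ ENNReal.ofReal (Real.exp s)} with hA'
  have hA'm : MeasurableSet A' := measurableSet_le hint measurable_const
  have hF : Measurable (A'.indicator (1 : E → ℝ≥0∞)) := measurable_one.indicator hA'm
  have key : ∀ a : Fin (m + 1), (Measure.pi fun _ : Fin (m + 1) => μ)
      {X | X a ∈ A ∧ τ ≤ ∑ l, φ (X a) (X (a.succAbove l))} ≤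
      ENNReal.ofReal (Real.exp (m * s - τ)) := by
    intro a
    have hsub : {X : Fin (m + 1) → E | X a ∈ A ∧ τ ≤ ∑ l, φ (X a) (X (a.succAbove l))} ⊆
        {X | ENNReal.ofReal (Real.exp τ) ≤
          A'.indicator 1 (X a) * ∏ l, g (X a) (X (a.succAbove l))} := by
      rintro X ⟨h1, h2⟩
      have h3 : X a ∈ A' := hs _ h1
      simp only [Set.mem_ofPred_eq, Set.indicator_of_mem h3, Pi.one_apply, one_mul, hg]
      rw [← ENNReal.ofReal_prod_of_nonneg fun _ _ => Real.exp_nonneg _, ← Real.exp_sum]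
      exact ENNReal.ofReal_le_ofReal (Real.exp_le_exp.2 h2)
    refine (measure_mono hsub).trans ?_
    have hg3 : ∀ l : Fin m, Measurable fun X : (Fin (m + 1) → E) =>
        g (X a) (X (a.succAbove l)) := fun l => by
      have h2 : Measurable fun X : (Fin (m + 1) → E) => (X a, X (a.succAbove l)) :=
        (measurable_pi_apply _).prodMk (measurable_pi_apply _)
      exact hgm.comp h2
    have hm := mul_meas_ge_le_lintegral (μ := Measure.pi fun _ : Fin (m + 1) => μ)
      (f := fun X => A'.indicator 1 (X a) * ∏ l, g (X a) (X (a.succAbove l))) (by fun_prop)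
      (ENNReal.ofReal (Real.exp τ))
    rw [lintegral_pi_pair_prod μ hF hgm] at hm
    have hm2 : ∫⁻ x, A'.indicator 1 x * (∫⁻ y, g x y ∂μ) ^ m ∂μ ≤
        ENNReal.ofReal (Real.exp s) ^ m := by
      calc _ ≤ ∫⁻ x, ENNReal.ofReal (Real.exp s) ^ m ∂μ := by
            refine lintegral_mono fun x => ?_
            by_cases hx : x ∈ A'
            · simpa [hx] using pow_le_pow_left' hx m
            · simp [hx]
        _ = _ := by simp
    rw [Real.exp_sub, ENNReal.ofReal_div_of_pos (Real.exp_pos _),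
      ENNReal.le_div_iff_mul_le (by simp [Real.exp_pos]) (by simp), mul_comm, Real.exp_nat_mul,
      ENNReal.ofReal_pow (Real.exp_nonneg _)]
    exact hm.trans hm2
  refine ENNReal.toReal_le_of_le_ofReal (by positivity) ?_
  have hU : {X : Fin (m + 1) → E | ∃ a, X a ∈ A ∧ τ ≤ ∑ l, φ (X a) (X (a.succAbove l))} =
      ⋃ a, {X | X a ∈ A ∧ τ ≤ ∑ l, φ (X a) (X (a.succAbove l))} := by
    ext X; simp
  rw [hU]
  refine (measure_iUnion_fintype_le _ _).trans ((Finset.sum_le_sum fun a _ => key a).trans ?_)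
  rw [Finset.sum_const, Finset.card_univ, Fintype.card_fin, nsmul_eq_mul,
    ENNReal.ofReal_mul (by positivity)]
  gcongr
  rw [show (m : ℝ) + 1 = ((m + 1 : ℕ) : ℝ) by push_cast; rfl, ENNReal.ofReal_natCast]

/-! ### Numbers of sample points in sets and balls -/

theorem ncard_ne_and_eq_sum {m : ℕ} (a : Fin (m + 1)) (P : Fin (m + 1) → Prop)
    [DecidablePred P] :
    (({l | l ≠ a ∧ P l}.ncard : ℕ) : ℝ) = ∑ l, if P (a.succAbove l) then (1 : ℝ) else 0 := by
  have : {l | l ≠ a ∧ P l} = a.succAbove '' {l | P (a.succAbove l)} := by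
    ext l
    constructor
    · rintro ⟨h1, h2⟩
      obtain ⟨j, rfl⟩ := Fin.exists_succAbove_eq h1
      exact ⟨j, h2, rfl⟩
    · rintro ⟨j, hj, rfl⟩
      exact ⟨Fin.succAbove_ne _ _, hj⟩
  rw [this, Set.ncard_image_of_injective _ Fin.succAbove_right_injective,
    Set.ncard_eq_toFinset_card']
  simp

theorem ncard_eq_sum {n : ℕ} (P : Fin n → Prop) [DecidablePred P] :
    (({l | P l}.ncard : ℕ) : ℝ) = ∑ l, if P l then (1 : ℝ) else 0 := by
  rw [Set.ncard_eq_toFinset_card']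
  simp

open Classical in
theorem lintegral_exp_mul_ite {E : Type*} [MeasurableSpace E] (μ : Measure E)
    [IsProbabilityMeasure μ] {B : Set E} (hB : MeasurableSet B) (c : ℝ) :
    ∫⁻ y, ENNReal.ofReal (Real.exp (c * if y ∈ B then 1 else 0)) ∂μ =
      ENNReal.ofReal (1 + (Real.exp c - 1) * μ.real B) := by
  have h : ∀ y, ENNReal.ofReal (Real.exp (c * if y ∈ B then 1 else 0)) =
      B.indicator (fun _ => ENNReal.ofReal (Real.exp c)) y + Bᶜ.indicator (fun _ => 1) y := by
    intro y
    by_cases hy : y ∈ B <;> simp [hy]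
  simp only [h]
  rw [lintegral_add_left (measurable_const.indicator hB), lintegral_indicator_const hB,
    lintegral_indicator_const hB.compl, one_mul, ← ofReal_measureReal, ← ofReal_measureReal,
    measureReal_compl hB, ← ENNReal.ofReal_mul (Real.exp_nonneg _), ← ENNReal.ofReal_add]
  · simp; ring_nf
  · positivity
  · simp [measureReal_le_one]

/-- At tilt `log 2` the moment is exactly `1 + μ(B)`, which is at most `exp q`. This fixed tilt
suffices for all upper tails of counts below. -/
theorem lintegral_exp_log_two_le {E : Type*} [MeasurableSpace E] (μ : Measure E)
    [IsProbabilityMeasure μ] {B : Set E} [DecidablePred (· ∈ B)] (hB : MeasurableSet B) {q : ℝ}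
    (hq : μ.real B ≤ q) :
    ∫⁻ y, ENNReal.ofReal (Real.exp (Real.log 2 * if y ∈ B then 1 else 0)) ∂μ ≤
      ENNReal.ofReal (Real.exp q) := by
  classical
  refine (le_of_eq (Eq.trans (by congr!) (lintegral_exp_mul_ite μ hB (Real.log 2)))).trans ?_
  refine ENNReal.ofReal_le_ofReal ?_
  rw [Real.exp_log two_pos]
  linarith [Real.add_one_le_exp q]

/-- At tilt `-log 2` the moment is `1 - μ(B)/2`; this is the source of the factor `1/2` in the lower
tails. -/
theorem lintegral_exp_neg_log_two_le {E : Type*} [MeasurableSpace E] (μ : Measure E)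
    [IsProbabilityMeasure μ] {B : Set E} [DecidablePred (· ∈ B)] (hB : MeasurableSet B) {q : ℝ}
    (hq : q ≤ μ.real B) :
    ∫⁻ y, ENNReal.ofReal (Real.exp (-Real.log 2 * if y ∈ B then 1 else 0)) ∂μ ≤
      ENNReal.ofReal (Real.exp (-q / 2)) := by
  classical
  refine (le_of_eq (Eq.trans (by congr!) (lintegral_exp_mul_ite μ hB (-Real.log 2)))).trans ?_
  refine ENNReal.ofReal_le_ofReal ?_
  rw [Real.exp_neg, Real.exp_log two_pos]
  linarith [Real.add_one_le_exp (-q / 2)]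

/-- Upper tail for the number of sample points in a set. -/
theorem measureReal_pi_le_ncard {E : Type*} [MeasurableSpace E] (μ : Measure E)
    [IsProbabilityMeasure μ] {B : Set E} (hB : MeasurableSet B) {q : ℝ} (hq : μ.real B ≤ q)
    (n : ℕ) (τ : ℝ) :
    (Measure.pi fun _ : Fin n => μ).real {X | τ ≤ (({l | X l ∈ B}.ncard : ℕ) : ℝ)} ≤
      Real.exp (n * q - τ * Real.log 2) := by
  classical
  have := measureReal_pi_le_exp μ (φ := fun y => Real.log 2 * if y ∈ B then 1 else 0)
    (measurable_const.mul (Measurable.ite hB measurable_const measurable_const))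
    (lintegral_exp_log_two_le μ hB hq) n (τ * Real.log 2)
  refine le_trans (measureReal_mono fun X hX => ?_) this
  simp only [Set.mem_ofPred_eq] at hX ⊢
  rw [ncard_eq_sum] at hX
  rw [← Finset.mul_sum, mul_comm]
  gcongr

/-- Lower tail for the number of sample points in a set. -/
theorem measureReal_pi_ncard_le {E : Type*} [MeasurableSpace E] (μ : Measure E)
    [IsProbabilityMeasure μ] {B : Set E} (hB : MeasurableSet B) {q : ℝ} (hq : q ≤ μ.real B)
    (n : ℕ) (τ : ℝ) :
    (Measure.pi fun _ : Fin n => μ).real {X | (({l | X l ∈ B}.ncard : ℕ) : ℝ) ≤ τ} ≤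
      Real.exp (τ * Real.log 2 - n * q / 2) := by
  classical
  have := measureReal_pi_le_exp μ (φ := fun y => -Real.log 2 * if y ∈ B then 1 else 0)
    (measurable_const.mul (Measurable.ite hB measurable_const measurable_const))
    (lintegral_exp_neg_log_two_le μ hB hq) n (-(τ * Real.log 2))
  refine le_trans (measureReal_mono fun X hX => ?_) (this.trans_eq (by ring_nf))
  simp only [Set.mem_ofPred_eq] at hX ⊢
  rw [ncard_eq_sum] at hX
  rw [← Finset.mul_sum, neg_mul, neg_le_neg_iff, mul_comm τ]
  gcongr

/-- For empty sets independence gives `(1 - μ(B))^n` directly, twice the exponent that the tilt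
`-log 2` would give. -/
theorem measureReal_pi_forall_notMem_le {E : Type*} [MeasurableSpace E] (μ : Measure E)
    [IsProbabilityMeasure μ] {B : Set E} (hB : MeasurableSet B) {q : ℝ} (hq : q ≤ μ.real B)
    (n : ℕ) :
    (Measure.pi fun _ : Fin n => μ).real {X | ∀ l, X l ∉ B} ≤ Real.exp (-(n * q)) := by
  have h : {X : Fin n → E | ∀ l, X l ∉ B} = Set.univ.pi fun _ => Bᶜ := by
    ext X; simp
  rw [h, measureReal_def, Measure.pi_pi, Finset.prod_const, Finset.card_univ, Fintype.card_fin,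
    ENNReal.toReal_pow, ← measureReal_def, measureReal_compl hB, ← mul_neg, Real.exp_nat_mul]
  have h1 : μ.real B ≤ 1 := measureReal_le_one
  have h2 := Real.add_one_le_exp (-q)
  simp only [probReal_univ]
  exact pow_le_pow_left₀ (by linarith) (by linarith) n

section Metric

variable {E : Type*} [PseudoMetricSpace E] [SecondCountableTopology E] [MeasurableSpace E]
  [OpensMeasurableSpace E]

/-- Probability that some sample point in `A` has many neighbors within distance `z`. -/
theorem measureReal_pi_exists_le_ncard_ball (μ : Measure E) [IsProbabilityMeasure μ] {A : Set E}
    {z q : ℝ} (hq : ∀ x ∈ A, μ.real (Metric.ball x z) ≤ q) (m : ℕ) (τ : ℝ) :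
    (Measure.pi fun _ : Fin (m + 1) => μ).real
      {X | ∃ a, X a ∈ A ∧ τ ≤ (({l | l ≠ a ∧ dist (X l) (X a) < z}.ncard : ℕ) : ℝ)} ≤
      (m + 1) * Real.exp (m * q - τ * Real.log 2) := by
  classical
  have hm : MeasurableSet {w : E × E | dist w.2 w.1 < z} :=
    measurableSet_lt (measurable_snd.dist measurable_fst) measurable_const
  have := measureReal_pi_exists_le_exp μ
    (φ := fun x y => Real.log 2 * if y ∈ Metric.ball x z then 1 else 0)
    (measurable_const.mul (Measurable.ite hm measurable_const measurable_const))
    (fun x hx => lintegral_exp_log_two_le μ Metric.isOpen_ball.measurableSet (hq x hx)) m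
    (τ * Real.log 2)
  refine le_trans (measureReal_mono fun X hX => ?_) this
  obtain ⟨a, ha, hX⟩ := hX
  refine ⟨a, ha, ?_⟩
  rw [ncard_ne_and_eq_sum] at hX
  rw [← Finset.mul_sum, mul_comm]
  gcongr
  exact hX

/-- Probability that some sample point in `A` has few neighbors within distance `z`. -/
theorem measureReal_pi_exists_ncard_ball_le (μ : Measure E) [IsProbabilityMeasure μ] {A : Set E}
    {z q : ℝ} (hq : ∀ x ∈ A, q ≤ μ.real (Metric.ball x z)) (m : ℕ) (τ : ℝ) :
    (Measure.pi fun _ : Fin (m + 1) => μ).real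
      {X | ∃ a, X a ∈ A ∧ (({l | l ≠ a ∧ dist (X l) (X a) < z}.ncard : ℕ) : ℝ) ≤ τ} ≤
      (m + 1) * Real.exp (τ * Real.log 2 - m * q / 2) := by
  classical
  have hm : MeasurableSet {w : E × E | dist w.2 w.1 < z} :=
    measurableSet_lt (measurable_snd.dist measurable_fst) measurable_const
  have := measureReal_pi_exists_le_exp μ
    (φ := fun x y => -Real.log 2 * if y ∈ Metric.ball x z then 1 else 0)
    (measurable_const.mul (Measurable.ite hm measurable_const measurable_const))
    (fun x hx => lintegral_exp_neg_log_two_le μ Metric.isOpen_ball.measurableSet (hq x hx)) m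
    (-(τ * Real.log 2))
  refine le_trans (measureReal_mono fun X hX => ?_) (this.trans_eq (by ring_nf))
  obtain ⟨a, ha, hX⟩ := hX
  refine ⟨a, ha, ?_⟩
  rw [ncard_ne_and_eq_sum] at hX
  rw [← Finset.mul_sum, neg_mul, neg_le_neg_iff, mul_comm τ]
  gcongr
  exact hX

end Metric

/-! ### Balls, nets and connectivity -/

theorem unitBallVolume_pos (d : ℕ) : 0 < unitBallVolume d :=
  ENNReal.toReal_pos (Metric.measure_ball_pos _ _ one_pos).ne' measure_ball_lt_top.ne

theorem volumeReal_ball {d : ℕ} (x : Euc d) {r : ℝ} (hr : 0 < r) :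
    volume.real (Metric.ball x r) = unitBallVolume d * r ^ d := by
  rw [measureReal_def, Measure.addHaar_ball_of_pos _ _ hr, ENNReal.toReal_mul,
    ENNReal.toReal_ofReal (by positivity), unitBallVolume, measureReal_def,
    finrank_euclideanSpace_fin, mul_comm]

theorem card_mul_le_volumeReal {d : ℕ} {A : Set (Euc d)} (hA : volume A ≠ ⊤) {r : ℝ} (hr : 0 < r)
    (T : Finset (Euc d)) (hT : ∀ y ∈ T, Metric.ball y (r / 2) ⊆ A)
    (hsep : ∀ x ∈ T, ∀ y ∈ T, x ≠ y → r ≤ dist x y) :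
    T.card * (unitBallVolume d * (r / 2) ^ d) ≤ volume.real A := by
  have hdisj : (T : Set (Euc d)).PairwiseDisjoint fun y => Metric.ball y (r / 2) := by
    intro x hx y hy hxy
    refine Metric.ball_disjoint_ball ?_
    linarith [hsep x hx y hy hxy]
  have h1 := measureReal_biUnion_finset (μ := volume) hdisj
    (fun y _ => Metric.isOpen_ball.measurableSet) (fun y _ => measure_ball_lt_top.ne)
  rw [Finset.sum_congr rfl fun y _ => volumeReal_ball y (half_pos hr), Finset.sum_const,
    nsmul_eq_mul] at h1
  rw [← h1]
  exact measureReal_mono (Set.iUnion₂_subset hT) hA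

/-- A maximal `r`-separated subset, with a packing bound on its size. -/
theorem exists_separated_net {d : ℕ} {A D : Set (Euc d)} (hA : volume A ≠ ⊤) {r : ℝ} (hr : 0 < r)
    (hD : ∀ x ∈ D, Metric.ball x r ⊆ A) :
    ∃ T : Finset (Euc d), (∀ y ∈ T, y ∈ D) ∧ (∀ x ∈ D, ∃ y ∈ T, dist x y < r) ∧
      T.card * (unitBallVolume d * (r / 2) ^ d) ≤ volume.real A := by
  classical
  set Q : Finset (Euc d) → Prop := fun T =>
    (∀ y ∈ T, y ∈ D) ∧ ∀ x ∈ T, ∀ y ∈ T, x ≠ y → r ≤ dist x y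
  have hv : 0 < unitBallVolume d * (r / 2) ^ d := by
    have := unitBallVolume_pos d
    positivity
  have hcard : ∀ T, Q T → T.card * (unitBallVolume d * (r / 2) ^ d) ≤ volume.real A := fun T hT =>
    card_mul_le_volumeReal hA hr T (fun y hy =>
      (Metric.ball_subset_ball (by linarith)).trans (hD y (hT.1 y hy))) hT.2
  obtain ⟨N, hN⟩ := exists_nat_ge (volume.real A / (unitBallVolume d * (r / 2) ^ d))
  have hbd : ∀ T, Q T → T.card ≤ N := fun T hT => by
    have h := (le_div_iff₀ hv).2 (hcard T hT)
    exact_mod_cast h.trans hN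
  set P : ℕ → Prop := fun n => ∃ T, Q T ∧ T.card = n
  have hP0 : P 0 := ⟨∅, ⟨by simp, by simp⟩, by simp⟩
  -- The packing bound caps the size of separated sets, so one of greatest cardinality exists; it is
  -- a net because no point can be added to it.
  obtain ⟨T, hT, hTc⟩ := Nat.findGreatest_spec (P := P) (Nat.zero_le N) hP0
  refine ⟨T, hT.1, fun x hx => ?_, hcard T hT⟩
  by_contra! hcon
  have hxT : x ∉ T := fun h => by
    have := hcon x h
    rw [dist_self] at this
    linarith
  have hQ : Q (insert x T) := by
    refine ⟨fun y hy => ?_, fun y hy y' hy' hne => ?_⟩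
    · rcases Finset.mem_insert.1 hy with rfl | hy
      · exact hx
      · exact hT.1 y hy
    · rcases Finset.mem_insert.1 hy with rfl | hy
      · rcases Finset.mem_insert.1 hy' with rfl | hy'
        · exact absurd rfl hne
        · exact hcon y' hy'
      · rcases Finset.mem_insert.1 hy' with rfl | hy'
        · rw [dist_comm]; exact hcon y ‹_›
        · exact hT.2 y hy y' hy' hne
  have h1 : (insert x T).card ≤ Nat.findGreatest P N :=
    Nat.le_findGreatest (hbd _ hQ) ⟨_, hQ, rfl⟩
  rw [Finset.card_insert_of_notMem hxT, ← hTc] at h1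
  omega

/-- A graph on points of a set `C` is connected if it contains all short edges and if each ball of
a net of a connected subset `D`, from which `C` can be reached, contains a vertex. -/
theorem reachable_of_net {E ι : Type*} [PseudoMetricSpace E] {C D : Set E} {T : Finset E} {r : ℝ}
    (hD : IsConnected D) (hTsub : ∀ y ∈ T, y ∈ D)
    (hT : ∀ y ∈ T, Metric.ball y r ⊆ C) (hr : 0 < r)
    (hTD : ∀ x ∈ D, ∃ y ∈ T, dist x y < r) (hCD : ∀ x ∈ C, Metric.infDist x D ≤ r)
    {X : ι → E} {G : SimpleGraph ι}
    (hG : ∀ a b, a ≠ b → X a ∈ C → X b ∈ C → dist (X a) (X b) < 4 * r → G.Adj a b)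
    (hX : ∀ y ∈ T, ∃ a, dist (X a) y < r) {a b : ι} (ha : X a ∈ C) (hb : X b ∈ C) :
    G.Reachable a b := by
  have hG' : ∀ a b, X a ∈ C → X b ∈ C → dist (X a) (X b) < 4 * r → G.Reachable a b := by
    intro a b ha hb hab
    by_cases h : a = b
    · rw [h]
    · exact (hG a b h ha hb hab).reachable
  have hC : ∀ y ∈ T, ∀ a, dist (X a) y < r → X a ∈ C := fun y hy a h => hT y hy h
  have key : ∀ a, X a ∈ C → ∃ y ∈ T, ∃ c, dist (X c) y < r ∧ G.Reachable a c := by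
    intro a ha
    -- The infimum need not be attained, hence `2r` instead of `r`; the chain `2r + r + r` is still
    -- within the edge length `4r`.
    obtain ⟨x, hx, hax⟩ := (Metric.infDist_lt_iff hD.nonempty).1
      ((hCD _ ha).trans_lt (by linarith : r < 2 * r))
    obtain ⟨y, hy, hxy⟩ := hTD x hx
    obtain ⟨c, hc⟩ := hX y hy
    refine ⟨y, hy, c, hc, hG' a c ha (hC y hy c hc) ?_⟩
    have h1 := dist_triangle4 (X a) x y (X c)
    rw [dist_comm y] at h1
    linarith
  have hsame : ∀ y ∈ T, ∀ y' ∈ T, ∀ x, dist x y < r → dist x y' < r → ∀ c c', dist (X c) y < r →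
      dist (X c') y' < r → G.Reachable c c' := by
    intro y hy y' hy' x hxy hxy' c c' hc hc'
    refine hG' c c' (hC y hy c hc) (hC y' hy' c' hc') ?_
    have h1 := dist_triangle4 (X c) y x y'
    have h2 := dist_triangle (X c) y' (X c')
    rw [dist_comm y' (X c')] at h2
    rw [dist_comm y x] at h1
    linarith
  obtain ⟨y₀, hy₀, c₀, hc₀, hac₀⟩ := key a ha
  obtain ⟨y₁, hy₁, c₁, hc₁, hbc₁⟩ := key b hb
  suffices h : ∀ c, dist (X c) y₁ < r → G.Reachable c₀ c from
    (hac₀.trans (h c₁ hc₁)).trans hbc₁.symm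
  set good : E → Prop := fun y => ∀ c, dist (X c) y < r → G.Reachable c₀ c with hgood
  by_contra hbad
  have hopen : ∀ s : Set E, IsOpen (⋃ y ∈ s, Metric.ball y r) := fun s =>
    isOpen_biUnion fun y _ => Metric.isOpen_ball
  -- The balls whose sample points are reachable from `c₀` and the remaining balls form two open
  -- sets covering `D`, both meeting it. By connectedness they overlap, and two overlapping balls
  -- have mutually adjacent (or equal) sample points.
  obtain ⟨x, -, hx1, hx2⟩ := hD.isPreconnected _ _ (hopen {y | y ∈ T ∧ good y})
    (hopen {y | y ∈ T ∧ ¬ good y})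
    (fun x hx => by
      obtain ⟨y, hy, hxy⟩ := hTD x hx
      by_cases h : good y
      · exact Or.inl (Set.mem_biUnion (x := y) ⟨hy, h⟩ hxy)
      · exact Or.inr (Set.mem_biUnion (x := y) ⟨hy, h⟩ hxy))
    ⟨y₀, hTsub y₀ hy₀, Set.mem_biUnion (x := y₀)
      ⟨hy₀, fun c hc => hsame y₀ hy₀ y₀ hy₀ y₀ (by simpa) (by simpa) _ _ hc₀ hc⟩
      (Metric.mem_ball_self hr)⟩
    ⟨y₁, hTsub y₁ hy₁, Set.mem_biUnion (x := y₁) ⟨hy₁, hbad⟩ (Metric.mem_ball_self hr)⟩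
  simp only [Set.mem_iUnion, Metric.mem_ball] at hx1 hx2
  obtain ⟨y, ⟨hy, hyg⟩, hxy⟩ := hx1
  obtain ⟨y', ⟨hy', hyb⟩, hxy'⟩ := hx2
  obtain ⟨c, hc⟩ := hX y hy
  exact hyb fun c' hc' => (hyg c hc).trans (hsame y hy y' hy' x hxy hxy' c c' hc hc')

theorem exists_adj_of_reachable {ι : Type*} {G : SimpleGraph ι} {a b : ι} (h : G.Reachable a b)
    (P : ι → Prop) (ha : P a) (hb : ¬ P b) : ∃ u v, G.Adj u v ∧ P u ∧ ¬ P v := by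
  obtain ⟨w⟩ := h
  obtain ⟨e, -, h1, h2⟩ := w.exists_boundary_dart {x | P x} ha hb
  exact ⟨_, _, e.adj, h1, h2⟩

/-- A ball that misses the frontier is covered by the disjoint open sets `interior A` and the
complement of `closure A`; being connected, it lies in the one containing its center. -/
theorem ball_subset_of_lt_infDist_frontier {E : Type*} [NormedAddCommGroup E] [NormedSpace ℝ E]
    {A : Set E} {x : E} (hx : x ∈ A) {r : ℝ} (hr : 0 < r)
    (h : r < Metric.infDist x (frontier A)) : Metric.ball x r ⊆ A := by
  have hdisj : ∀ y ∈ Metric.ball x r, y ∉ frontier A := fun y hy hyA => by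
    have := Metric.infDist_le_dist_of_mem (x := x) hyA
    rw [dist_comm] at this
    rw [Metric.mem_ball] at hy
    linarith
  have hmem : x ∈ interior A := by
    by_contra hxi
    exact hdisj x (Metric.mem_ball_self hr) ⟨subset_closure hx, hxi⟩
  refine ((convex_ball x r).isPreconnected.subset_left_of_subset_union isOpen_interior
    (isClosed_closure (s := A)).isOpen_compl
    (Set.disjoint_compl_right_iff_subset.2 interior_subset_closure) (fun y hy => ?_)
    ⟨x, Metric.mem_ball_self hr, hmem⟩).trans interior_subset
  by_contra hcon
  simp only [Set.mem_union, not_or, Set.mem_compl_iff, not_not] at hcon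
  exact hdisj y hy ⟨hcon.2, hcon.1⟩

/-! ### The density and its clusters -/

theorem IsBoundedDensity.isProbabilityMeasure {d : ℕ} {p : Euc d → ℝ} (hp : IsBoundedDensity p) :
    IsProbabilityMeasure (densityMeasure p) :=
  ⟨by rw [densityMeasure, withDensity_apply _ MeasurableSet.univ, Measure.restrict_univ,
    hp.mass_one]⟩

theorem IsBoundedDensity.measureReal_le {d : ℕ} {p : Euc d → ℝ} {B : Set (Euc d)}
    (hB : MeasurableSet B) (hBt : volume B ≠ ⊤) {c : ℝ} (hc : 0 ≤ c) (h : ∀ y ∈ B, p y ≤ c) :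
    (densityMeasure p).real B ≤ c * volume.real B := by
  rw [densityMeasure, measureReal_def, withDensity_apply _ hB]
  refine ENNReal.toReal_le_of_le_ofReal (by positivity) ?_
  rw [ENNReal.ofReal_mul hc, measureReal_def, ENNReal.ofReal_toReal hBt, ← setLIntegral_const]
  exact setLIntegral_mono measurable_const fun y hy => ENNReal.ofReal_le_ofReal (h y hy)

theorem IsBoundedDensity.le_measureReal {d : ℕ} {p : Euc d → ℝ} (hp : IsBoundedDensity p)
    {B : Set (Euc d)}
    (hB : MeasurableSet B) (hBt : volume B ≠ ⊤) {c : ℝ} (hc : 0 ≤ c)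
    (h : ∀ᵐ y, y ∈ B → c ≤ p y) :
    c * volume.real B ≤ (densityMeasure p).real B := by
  have := hp.isProbabilityMeasure
  rw [measureReal_def (densityMeasure p), ← ENNReal.ofReal_le_iff_le_toReal (measure_ne_top _ _),
    densityMeasure, withDensity_apply _ hB, ENNReal.ofReal_mul hc, measureReal_def,
    ENNReal.ofReal_toReal hBt, ← setLIntegral_const]
  exact setLIntegral_mono_ae' hB (h.mono fun y hy hyB => ENNReal.ofReal_le_ofReal (hy hyB))

theorem levelSet_anti {d : ℕ} (p : Euc d → ℝ) {s s' : ℝ} (h : s ≤ s') :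
    levelSet p s' ⊆ levelSet p s := closure_mono fun _ hx => h.trans hx

theorem levelSet_eq_univ {d : ℕ} {p : Euc d → ℝ} (hp : IsBoundedDensity p) {s : ℝ} (h : s ≤ 0) :
    levelSet p s = Set.univ := by
  have : {x | s ≤ p x} = Set.univ := Set.eq_univ_of_forall fun x => h.trans (hp.nonneg x)
  rw [levelSet, this, closure_univ]

theorem levelComponent_anti {d : ℕ} (p : Euc d → ℝ) {s s' : ℝ} (h : s ≤ s') (A : Set (Euc d)) :
    levelComponent p s' A ⊆ levelComponent p s A :=
  Set.iUnion₂_mono fun _ _ => connectedComponentIn_mono _ (levelSet_anti p h)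

/-! ### Separation of the clusters and bounds on the density near them -/

namespace ClusterModel

variable {d : ℕ} {p : Euc d → ℝ} (S : ClusterModel p) (i : Fin S.m)

theorem C_eq_component : ∃ x ∈ levelSet p S.t, S.C i = connectedComponentIn (levelSet p S.t) x := by
  have : S.C i ∈ Set.range S.C := ⟨i, rfl⟩
  rw [S.C_range] at this
  exact this

theorem C_subset : S.C i ⊆ levelSet p S.t := by
  obtain ⟨x, -, h⟩ := S.C_eq_component i
  rw [h]
  exact connectedComponentIn_subset _ _

theorem C_nonempty : (S.C i).Nonempty := by
  obtain ⟨x, hx, h⟩ := S.C_eq_component i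
  rw [h]
  exact ⟨x, mem_connectedComponentIn hx⟩

theorem exists_mem_C {x : Euc d} (hx : x ∈ levelSet p S.t) : ∃ j, x ∈ S.C j := by
  have : connectedComponentIn (levelSet p S.t) x ∈ Set.range S.C := by
    rw [S.C_range]; exact ⟨x, hx, rfl⟩
  obtain ⟨j, hj⟩ := this
  exact ⟨j, hj ▸ mem_connectedComponentIn hx⟩

theorem C_subset_Cminus {s : ℝ} (hs : 0 ≤ s) : S.C i ⊆ S.Cminus i s := fun x hx =>
  Set.mem_biUnion hx (mem_connectedComponentIn
    (levelSet_anti p (by linarith) (S.C_subset i hx)))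

theorem Cminus_mono {s s' : ℝ} (h : s ≤ s') : S.Cminus i s ⊆ S.Cminus i s' :=
  levelComponent_anti p (by linarith) _

theorem u_le_dist_of_mem {i j : Fin S.m} (hij : i ≠ j) {x y : Euc d}
    (hx : x ∈ S.Cminus i (2 * S.εtilde)) (hy : y ∈ S.Cminus j (2 * S.εtilde)) :
    S.u i ≤ dist x y := S.u_le_dist i j hij x hx y hy

theorem C_subset_Cminus_two : S.C i ⊆ S.Cminus i (2 * S.εtilde) :=
  S.C_subset_Cminus i (by linarith [S.εtilde_pos])

theorem C_disjoint {i j : Fin S.m} (hij : i ≠ j) {x : Euc d} (hx : x ∈ S.C i) : x ∉ S.C j :=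
  fun hy => by
    have := S.u_le_dist_of_mem hij (S.C_subset_Cminus_two i hx) (S.C_subset_Cminus_two j hy)
    rw [dist_self] at this
    linarith [S.u_pos i]

theorem C_measurableSet : MeasurableSet (S.C i) := (S.C_compact i).isClosed.measurableSet

theorem C_volume_ne_top : volume (S.C i) ≠ ⊤ := (S.C_compact i).measure_lt_top.ne

variable {S i}

theorem le_pmax (hp : IsBoundedDensity p) {x : Euc d} (hx : x ∈ S.C i) : p x ≤ S.pmax i := by
  obtain ⟨B, hB⟩ := hp.bounded
  exact le_csSup ⟨B, by rintro _ ⟨y, -, rfl⟩; exact hB y⟩ ⟨x, hx, rfl⟩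

/-- Since `L(t)` is a closure, `p ≥ t` may fail at a given point of the cluster. But such a point is
a limit of points with `p ≥ t`, and the other clusters are finitely many closed sets that miss it,
so nearby points with `p ≥ t` lie in the same cluster. -/
theorem t_le_pmax (hp : IsBoundedDensity p) : S.t ≤ S.pmax i := by
  obtain ⟨x, hx⟩ := S.C_nonempty i
  have hclosed : IsClosed (⋃ j ∈ {j | j ≠ i}, S.C j) :=
    (Set.toFinite _).isClosed_biUnion fun j _ => (S.C_compact j).isClosed
  have hx' : x ∈ (⋃ j ∈ {j | j ≠ i}, S.C j)ᶜ := by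
    simp only [Set.mem_compl_iff, Set.mem_iUnion, not_exists]
    exact fun j hj => S.C_disjoint (Ne.symm hj) hx
  obtain ⟨y, hy1, hy2⟩ := mem_closure_iff.1 (S.C_subset i hx) _ hclosed.isOpen_compl hx'
  obtain ⟨j, hj⟩ := S.exists_mem_C (subset_closure hy2)
  have hji : j = i := by
    by_contra h
    exact hy1 (Set.mem_biUnion (x := j) h hj)
  exact hy2.trans (le_pmax hp (hji ▸ hj))

theorem pmax_pos (hp : IsBoundedDensity p) : 0 < S.pmax i := S.t_pos.trans_le (t_le_pmax hp)

/-- A point with `p ≥ t` lies in some cluster, and the other clusters are at distance at least `u`;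
where `p < t`, use `t ≤ pmax`. -/
theorem le_pmax_of_dist_lt (hp : IsBoundedDensity p) {x y : Euc d} (hx : x ∈ S.C i)
    (hxy : dist y x < S.u i) : p y ≤ S.pmax i := by
  by_cases hy : S.t ≤ p y
  · obtain ⟨j, hj⟩ := S.exists_mem_C (subset_closure hy)
    by_cases hji : i = j
    · exact le_pmax hp (hji ▸ hj)
    · have := S.u_le_dist_of_mem hji (S.C_subset_Cminus_two i hx) (S.C_subset_Cminus_two j hj)
      rw [dist_comm] at this
      linarith
  · exact (not_le.1 hy).le.trans (t_le_pmax hp)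

theorem measureReal_ball_le (hp : IsBoundedDensity p) {x : Euc d} (hx : x ∈ S.C i) {z : ℝ}
    (hz : 0 < z) (hzu : z ≤ S.u i) :
    (densityMeasure p).real (Metric.ball x z) ≤ S.pmax i * (unitBallVolume d * z ^ d) := by
  rw [← volumeReal_ball x hz]
  exact IsBoundedDensity.measureReal_le Metric.isOpen_ball.measurableSet measure_ball_lt_top.ne
    (pmax_pos hp).le fun y hy => le_pmax_of_dist_lt hp hx (lt_of_lt_of_le hy hzu)

theorem ρ_le_pmax_mul (hp : IsBoundedDensity p) :
    S.ρ i ≤ S.pmax i * (unitBallVolume d * S.u i ^ d) := by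
  obtain ⟨x, hx⟩ := S.C_nonempty i
  exact (S.ρ_le i x (S.C_subset_Cminus_two i hx)).trans
    (measureReal_ball_le hp hx (S.u_pos i) le_rfl)

theorem volumeReal_C_pos (hβ : 0 < S.β i) : 0 < volume.real (S.C i) := by
  refine (measureReal_nonneg).lt_of_ne' fun h => ?_
  have h0 : volume (S.C i) = 0 := by
    rwa [measureReal_def, ENNReal.toReal_eq_zero_iff, or_iff_left (S.C_volume_ne_top i)] at h
  have h1 : densityMeasure p (S.C i) = 0 := withDensity_absolutelyContinuous _ _ h0
  rw [β, measureReal_def, h1] at hβ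
  simp at hβ

theorem measure_compl_levelSet (hS : S.NoiseFree) :
    densityMeasure p (levelSet p S.t)ᶜ = 0 := by
  have hm : MeasurableSet (levelSet p S.t)ᶜ := isClosed_closure.measurableSet.compl
  rw [densityMeasure, withDensity_apply _ hm, setLIntegral_congr_fun (g := fun _ => 0) hm]
  · simp
  · intro x hx
    simp [hS.2 x hx]

/-- The `u`-ball about a cluster point has mass at least `ρ > 0` and meets `L(t)` only in the
cluster. This makes the volume, and hence the argument of the logarithm in Condition 1, positive. -/
theorem β_pos_of_noiseFree (hp : IsBoundedDensity p) (hS : S.NoiseFree) : 0 < S.β i := by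
  have := hp.isProbabilityMeasure
  obtain ⟨x, hx⟩ := S.C_nonempty i
  refine (S.ρ_pos i).trans_le ((S.ρ_le i x (S.C_subset_Cminus_two i hx)).trans ?_)
  have hsub : Metric.ball x (S.u i) ⊆ S.C i ∪ (levelSet p S.t)ᶜ := by
    intro y hy
    by_cases hyL : y ∈ levelSet p S.t
    · obtain ⟨j, hj⟩ := S.exists_mem_C hyL
      by_cases hji : i = j
      · exact Or.inl (hji ▸ hj)
      · have := S.u_le_dist_of_mem hji (S.C_subset_Cminus_two i hx) (S.C_subset_Cminus_two j hj)
        rw [Metric.mem_ball, dist_comm] at hy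
        linarith
    · exact Or.inr hyL
  refine (measureReal_mono hsub).trans ((measureReal_union_le _ _).trans ?_)
  rw [measureReal_def _ (levelSet p S.t)ᶜ, measure_compl_levelSet hS]
  simp [β]

/-- Below the maximal covering radius, the inner part of the cluster is as required. -/
theorem inner_of_lt_νmax {r : ℝ} (hr : 0 < r) (h : r < S.νmax i) :
    IsConnected (S.C i \ collar (S.C i) r) ∧
      ∀ x ∈ S.C i, Metric.infDist x (S.C i \ collar (S.C i) r) ≤ r := by
  have hne : {ν | 0 < ν ∧ ν ≤ S.κ i ∧ ∀ r, 0 < r → r ≤ ν →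
      IsConnected (S.C i \ collar (S.C i) r) ∧
        ∀ x ∈ S.C i, Metric.infDist x (S.C i \ collar (S.C i) r) ≤ r}.Nonempty := by
    -- If no radius is admissible, the supremum has the default value `0`, contradicting `0 < r <
    -- νmax`.
    by_contra hcon
    rw [νmax, maxCoveringRadius, Set.not_nonempty_iff_eq_empty.1 hcon, Real.sSup_empty] at h
    linarith
  obtain ⟨ν, hν, hrν⟩ := exists_lt_of_lt_csSup hne h
  exact hν.2.2 r hr hrν.le

theorem νmax_nonneg : 0 ≤ S.νmax i := Real.sSup_nonneg fun _ h => h.1.le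

theorem ball_subset_C {r : ℝ} (hr : 0 < r) {x : Euc d} (hx : x ∈ S.C i \ collar (S.C i) r) :
    Metric.ball x r ⊆ S.C i := by
  refine ball_subset_of_lt_infDist_frontier hx.1 hr ?_
  by_contra h
  exact hx.2 ⟨hx.1, not_lt.1 h⟩

end ClusterModel

/-! ### The exponents -/

/-- `hc` and `hK16` give `K ≥ 8 log n`. The gap between `log 2 - 1/2` and `1/16`, times `K`, pays
for the factor `n` and for rounding `K` to `k`. -/
theorem mul_exp_neg_le_of_log_le {n k K a c : ℝ} (hn : 2 ≤ n) (ha : a ≤ 1 / 16)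
    (hc : 0 ≤ Real.log n + 2 * Real.log c) (hK16 : 16 * (Real.log n + Real.log c) ≤ K)
    (hkK : |k - K| < 1) :
    n * Real.exp ((k - 1) / 2 - k * Real.log 2) ≤ Real.exp (-((K - 1) * a)) := by
  have hln : Real.log 2 ≤ Real.log n := Real.log_le_log two_pos hn
  have hl2 := Real.log_two_gt_d9
  obtain ⟨h1, h2⟩ := abs_lt.1 hkK
  have hexp : n = Real.exp (Real.log n) := (Real.exp_log (by linarith)).symm
  nth_rewrite 1 [hexp]
  rw [← Real.exp_add]
  refine Real.exp_le_exp.2 ?_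
  have h3 : (K - 1) * a ≤ (K - 1) * (1 / 16) := mul_le_mul_of_nonneg_left ha (by linarith)
  have h4 : k * 0.693 ≤ k * Real.log 2 :=
    mul_le_mul_of_nonneg_left (by linarith) (by linarith)
  linarith

/-- Of the rate `2a`, one half cancels the number `N` of net balls through `hKa`, the other remains.
Because `k - 1 ≥ 3 > e`, even `log N ≤ log (c n) - 1` for positive `N`, and the spare `1` covers the
rounding. -/
theorem mul_exp_neg_le_of_mul_le {n k K a c N : ℝ} (hn : 2 ≤ n) (hc0 : 0 < c) (ha0 : 0 < a)
    (ha : a ≤ 1 / 16)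
    (hc : 0 ≤ Real.log n + 2 * Real.log c) (hK16 : 16 * (Real.log n + Real.log c) ≤ K)
    (hKa : Real.log n + Real.log c ≤ K * a)
    (hkK : |k - K| < 1) (hN : N * (k - 1) ≤ c * (n - 1)) :
    N * Real.exp (-(n * (2 * a * ((k - 1) / (n - 1))))) ≤ Real.exp (-((K - 1) * a)) := by
  have hln : Real.log 2 ≤ Real.log n := Real.log_le_log two_pos hn
  have hl2 := Real.log_two_gt_d9
  obtain ⟨h1, h2⟩ := abs_lt.1 hkK
  have hk : 3 ≤ k - 1 := by linarith
  have h3 : N * 3 ≤ c * n := by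
    rcases le_or_gt N 0 with h | h
    · nlinarith
    · nlinarith
  have he : Real.exp 1 ≤ 3 := Real.exp_one_lt_d9.le.trans (by norm_num)
  have h4 : N ≤ Real.exp (Real.log n + Real.log c - 1) := by
    rw [Real.exp_sub, Real.exp_add, Real.exp_log (by linarith), Real.exp_log hc0,
      le_div_iff₀ (Real.exp_pos _)]
    rcases le_or_gt N 0 with h | h
    · nlinarith [Real.exp_pos 1]
    · nlinarith [Real.exp_pos 1]
  refine (mul_le_mul_of_nonneg_right h4 (Real.exp_nonneg _)).trans ?_
  rw [← Real.exp_add]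
  refine Real.exp_le_exp.2 ?_
  have h5 : 2 * a * (k - 1) ≤ n * (2 * a * ((k - 1) / (n - 1))) := by
    have h6 : k - 1 ≤ n * ((k - 1) / (n - 1)) := by
      rw [mul_div_assoc', le_div_iff₀ (by linarith)]
      nlinarith
    nlinarith
  nlinarith

/-- Half of the exponent `(n-1)ρ/2` is given up; by `hKρ` it is at least `K/2`. Together with the
allowed `(K-1)/2` it outweighs `(k-1) log 2 + log n`, since `log 2 < 1` and `K ≥ 8 log n`. -/
theorem mul_exp_le_exp_neg_between {n k K ρ c : ℝ} (hn : 2 ≤ n)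
    (hc : 0 ≤ Real.log n + 2 * Real.log c) (hK16 : 16 * (Real.log n + Real.log c) ≤ K)
    (hkK : |k - K| < 1) (hKρ : K ≤ (n - 1) * (ρ / 2)) :
    n * Real.exp ((k - 1) * Real.log 2 - (n - 1) * ρ / 2) ≤
      Real.exp (-((n - 1) / 2 * (ρ / 2 - (K - 1) / (n - 1)))) := by
  have hln : Real.log 2 ≤ Real.log n := Real.log_le_log two_pos hn
  have hl2 := Real.log_two_gt_d9
  have hl2' := Real.log_two_lt_d9
  obtain ⟨h1, h2⟩ := abs_lt.1 hkK
  have hexp : n = Real.exp (Real.log n) := (Real.exp_log (by linarith)).symm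
  nth_rewrite 1 [hexp]
  rw [← Real.exp_add]
  refine Real.exp_le_exp.2 ?_
  have h3 : (n - 1) / 2 * (ρ / 2 - (K - 1) / (n - 1)) = (n - 1) * ρ / 4 - (K - 1) / 2 := by
    have : n - 1 ≠ 0 := by linarith
    field_simp
    ring
  have h4 : (k - 1) * Real.log 2 ≤ (k - 1) * 0.6932 :=
    mul_le_mul_of_nonneg_left (by linarith) (by linarith)
  rw [h3]
  linarith

/-! ### The events in the mutual nearest-neighbor graph -/

theorem dist_lt_of_mutualKNN_adj {d n : ℕ} {X : Fin n → Euc d} {k : ℕ} {u : ℝ} {a b : Fin n}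
    (h : (mutualKNN X k).Adj a b)
    (hcard : k ≤ {l | l ≠ a ∧ dist (X l) (X a) < u}.ncard) : dist (X b) (X a) < u := by
  by_contra! hu
  have h1 := h.1.2
  have h2 : {l | l ≠ a ∧ dist (X l) (X a) < u} ⊆
      {l | l ≠ a ∧ dist (X l) (X a) < dist (X b) (X a)} := fun l hl => ⟨hl.1, hl.2.trans_le hu⟩
  exact absurd (hcard.trans (Set.ncard_le_ncard h2 (Set.toFinite _))) (not_le.2 h1)

theorem mutualKNN_adj_of_dist_lt {d n : ℕ} {X : Fin n → Euc d} {k : ℕ} {z : ℝ} {a b : Fin n}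
    (hab : a ≠ b) (h : dist (X a) (X b) < z)
    (ha : {l | l ≠ a ∧ dist (X l) (X a) < z}.ncard < k)
    (hb : {l | l ≠ b ∧ dist (X l) (X b) < z}.ncard < k) : (mutualKNN X k).Adj a b := by
  refine ⟨⟨hab.symm, ?_⟩, ⟨hab, ?_⟩⟩
  · refine lt_of_le_of_lt (Set.ncard_le_ncard ?_ (Set.toFinite _)) ha
    exact fun l hl => ⟨hl.1, hl.2.trans (by rwa [dist_comm])⟩
  · refine lt_of_le_of_lt (Set.ncard_le_ncard ?_ (Set.toFinite _)) hb
    exact fun l hl => ⟨hl.1, hl.2.trans h⟩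

namespace ClusterModel

variable {d : ℕ} {p : Euc d → ℝ} {S : ClusterModel p} {i : Fin S.m}

/-- The constant in the logarithm of the lower bound on `k`. -/
noncomputable def logFactor (S : ClusterModel p) (i : Fin S.m) : ℝ :=
  2 * 8 ^ d * S.pmax i * volume.real (S.C i)

theorem logFactor_pos (hp : IsBoundedDensity p) (hβ : 0 < S.β i) : 0 < S.logFactor i := by
  have := pmax_pos (i := i) hp
  have := volumeReal_C_pos hβ
  unfold logFactor
  positivity

/-- The assumption `d ≥ 1` enters here: `4^(d+1) ≥ 16`. The value `1/16` has to stay below `log 2 -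
1/2` in the union bound over the sample points. -/
theorem withinRate_le (hd : 1 ≤ d) (hp : IsBoundedDensity p) :
    1 / 4 ^ (d + 1) * (S.t / S.pmax i) ≤ 1 / 16 := by
  have h1 : S.t / S.pmax i ≤ 1 := (div_le_one (pmax_pos hp)).2 (t_le_pmax hp)
  have h2 : (4 : ℝ) ^ 2 ≤ 4 ^ (d + 1) := pow_le_pow_right₀ (by norm_num) (by omega)
  have h3 : 1 / (4 : ℝ) ^ (d + 1) ≤ 1 / 16 := one_div_le_one_div_of_le (by norm_num) (by linarith)
  have h4 : 0 ≤ S.t / S.pmax i := div_nonneg S.t_pos.le (pmax_pos hp).le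
  nlinarith

theorem withinRate_pos (hp : IsBoundedDensity p) : 0 < 1 / 4 ^ (d + 1) * (S.t / S.pmax i) := by
  have := pmax_pos (i := i) hp
  have := S.t_pos
  positivity

theorem withinExponent_eq (n : ℕ) (K : ℝ) :
    S.withinExponent i n K = (K - 1) * (1 / 4 ^ (d + 1) * (S.t / S.pmax i)) := by
  unfold withinExponent
  ring

/-- The sample size is large enough, independently of the number of neighbors. -/
structure LargeSample (S : ClusterModel p) (i : Fin S.m) (n : ℕ) : Prop where
  two_le : (2 : ℝ) ≤ n
  log_factor : 0 ≤ Real.log n + 2 * Real.log (S.logFactor i)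
  log_βtilde : 0 ≤ Real.log (S.βtilde i * n)

theorem eventually_largeSample (S : ClusterModel p) (i : Fin S.m) :
    ∀ᶠ n : ℕ in Filter.atTop, S.LargeSample i n := by
  have hlog : Filter.Tendsto (fun n : ℕ => Real.log n) Filter.atTop Filter.atTop :=
    Real.tendsto_log_atTop.comp tendsto_natCast_atTop_atTop
  have h3 : ∀ᶠ n : ℕ in Filter.atTop, 0 ≤ Real.log (S.βtilde i * n) := by
    -- If `βtilde` were zero, the convention `log 0 = 0` settles the claim.
    rcases (show 0 ≤ S.βtilde i from measureReal_nonneg).eq_or_lt with h | h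
    · simp [← h]
    · filter_upwards [(tendsto_natCast_atTop_atTop (R := ℝ)).eventually_ge_atTop (1 / S.βtilde i)]
        with n hn
      refine Real.log_nonneg ?_
      rw [div_le_iff₀ h] at hn
      linarith
  filter_upwards [(tendsto_natCast_atTop_atTop (R := ℝ)).eventually_ge_atTop 2, h3,
    hlog.eventually_ge_atTop (-(2 * Real.log (S.logFactor i)))] with n h1 h2 h3
  exact ⟨h1, by linarith, h2⟩

theorem Condition1.log_le {n : ℕ} {K : ℝ} (h : S.Condition1 i n K) (hp : IsBoundedDensity p)
    (hβ : 0 < S.β i) (hn : S.LargeSample i n) :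
    Real.log n + Real.log (S.logFactor i) ≤ K * (1 / 4 ^ (d + 1) * (S.t / S.pmax i)) := by
  have h1 := h.1
  have hn0 : (n : ℝ) ≠ 0 := by linarith [hn.two_le]
  have hpm := pmax_pos (i := i) hp
  have ht := S.t_pos
  change 4 ^ (d + 1) * (S.pmax i / S.t) * Real.log (S.logFactor i * n) ≤ K at h1
  rw [Real.log_mul (logFactor_pos hp hβ).ne' hn0] at h1
  calc Real.log n + Real.log (S.logFactor i)
      = (4 ^ (d + 1) * (S.pmax i / S.t) * (Real.log (S.logFactor i) + Real.log n)) *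
        (1 / 4 ^ (d + 1) * (S.t / S.pmax i)) := by field_simp; ring
    _ ≤ _ := mul_le_mul_of_nonneg_right h1 (withinRate_pos hp).le

theorem Condition1.sixteen_log_le {n : ℕ} {K : ℝ} (h : S.Condition1 i n K) (hd : 1 ≤ d)
    (hp : IsBoundedDensity p) (hβ : 0 < S.β i) (hn : S.LargeSample i n) :
    16 * (Real.log n + Real.log (S.logFactor i)) ≤ K := by
  have h1 := h.log_le hp hβ hn
  have h2 := withinRate_le (S := S) (i := i) hd hp
  have h3 := withinRate_pos (S := S) (i := i) hp
  have h4 : 0 ≤ Real.log n := Real.log_nonneg (by linarith [hn.two_le])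
  have h5 := hn.log_factor
  have hK : 0 ≤ K := nonneg_of_mul_nonneg_left (by linarith : 0 ≤ K * _) h3
  nlinarith

theorem Condition1.le_mul_ρ {n : ℕ} {K : ℝ} (h : S.Condition1 i n K)
    (hn : S.LargeSample i n) : K ≤ ((n : ℝ) - 1) * (S.ρ i / 2) := by
  have h2 := hn.two_le
  refine h.2.trans (mul_le_mul_of_nonneg_left ((min_le_left _ _).trans ?_) (by linarith))
  have := hn.log_βtilde
  have : 0 ≤ 2 * Real.log (S.βtilde i * n) / n := by positivity
  linarith

/-- With high probability, no edges of the graph leave `C_-^{(i)}` over a large distance. -/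
theorem exists_between_event (hd : 1 ≤ d) (hp : IsBoundedDensity p) (hβ : 0 < S.β i) {n k : ℕ}
    {K : ℝ} (hn : S.LargeSample i n) (hK : S.Condition1 i n K) (hkK : |(k : ℝ) - K| < 1) :
    ∃ W : Set (Fin n → Euc d), (sampleLaw p n).real W ≤ Real.exp (-S.betweenExponent i n K) ∧
      ∀ X ∉ W, ∀ a b, X a ∈ S.Cminus i (2 * S.εtilde) → (mutualKNN X k).Adj a b →
        dist (X b) (X a) < S.u i := by
  have := hp.isProbabilityMeasure
  obtain ⟨m, rfl⟩ : ∃ m, n = m + 1 := ⟨n - 1, by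
    have : 2 ≤ n := by exact_mod_cast hn.two_le
    omega⟩
  -- Fewer than `k` neighbors means at most `k - 1`; this is where `k - 1` in the exponent comes
  -- from.
  have h1 := measureReal_pi_exists_ncard_ball_le (densityMeasure p)
    (A := S.Cminus i (2 * S.εtilde)) (z := S.u i) (S.ρ_le i) m ((k : ℝ) - 1)
  refine ⟨_, h1.trans ?_, fun X hX a b ha hab => dist_lt_of_mutualKNN_adj hab ?_⟩
  · have := mul_exp_le_exp_neg_between hn.two_le hn.log_factor (hK.sixteen_log_le hd hp hβ hn)
      hkK (hK.le_mul_ρ hn)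
    push_cast at this
    rw [add_sub_cancel_right] at this
    unfold betweenExponent
    push_cast
    rw [add_sub_cancel_right]
    exact this
  · by_contra! hlt
    refine hX ⟨a, ha, ?_⟩
    have : ({l | l ≠ a ∧ dist (X l) (X a) < S.u i}.ncard : ℝ) + 1 ≤ k := by exact_mod_cast hlt
    linarith

/-- With high probability, the sample points in the cluster are connected to each other within
the cluster. -/
theorem exists_within_event (hd : 1 ≤ d) (hp : IsBoundedDensity p)
    (hae : ∀ᵐ x, x ∈ levelSet p S.t → S.t ≤ p x) (hβ : 0 < S.β i) {n k : ℕ}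
    {K : ℝ} (hn : S.LargeSample i n) (hK : S.Condition1 i n K) (hkK : |(k : ℝ) - K| < 1) :
    ∃ W : Set (Fin n → Euc d), (sampleLaw p n).real W ≤ 2 * Real.exp (-S.withinExponent i n K) ∧
      ∀ X ∉ W, ∀ V : Set (Fin n), (∀ a, X a ∈ S.C i → a ∈ V) → ∀ a b : V, X a ∈ S.C i →
        X b ∈ S.C i → ((mutualKNN X k).induce V).Reachable a b := by
  have := hp.isProbabilityMeasure
  obtain ⟨m, rfl⟩ : ∃ m, n = m + 1 := ⟨n - 1, by
    have : 2 ≤ n := by exact_mod_cast hn.two_le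
    omega⟩
  have hn2 := hn.two_le
  have hK16 := hK.sixteen_log_le hd hp hβ hn
  have hKρ := hK.le_mul_ρ hn
  have hpm := pmax_pos (i := i) hp
  have hη := unitBallVolume_pos d
  have ht := S.t_pos
  obtain ⟨hk1, hk2⟩ := abs_lt.1 hkK
  have hlogn : Real.log 2 ≤ Real.log ((m + 1 : ℕ) : ℝ) := Real.log_le_log two_pos hn2
  have hl2 := Real.log_two_gt_d9
  have hlf := hn.log_factor
  have hm : (1 : ℝ) ≤ m := by push_cast at hn2; linarith
  have hk3 : (3 : ℝ) ≤ (k : ℝ) - 1 := by linarith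
  have hmsub : ((m + 1 : ℕ) : ℝ) - 1 = m := by push_cast; ring
  -- Half of `(k-1)/(n-1)`: a ball of this mass has `(k-1)/2` expected points among the other `m = n
  -- - 1`, which leaves room for the Chernoff bound at `k`.
  set q : ℝ := ((k : ℝ) - 1) / (2 * m) with hq
  have hq0 : 0 < q := by
    have : 0 < (k : ℝ) - 1 := by linarith
    positivity
  have hqK : q < K / (2 * m) := by
    rw [hq]; gcongr; linarith
  -- The solution of `pmax * η_d * (4r)^d = q`, where `4r` is the edge length required by
  -- `reachable_of_net`.
  set r : ℝ := (q / (S.pmax i * 4 ^ d * unitBallVolume d)) ^ ((d : ℝ)⁻¹) with hr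
  have hr0 : 0 < r := by positivity
  have hrd : r ^ d = q / (S.pmax i * 4 ^ d * unitBallVolume d) :=
    Real.rpow_inv_natCast_pow (by positivity) (by omega)
  have hqr : S.pmax i * (unitBallVolume d * (4 * r) ^ d) = q := by
    rw [mul_pow, hrd]
    field_simp
  -- The inequality is strict because `k - 1 < K`; strictness matters since `νmax` is a supremum.
  have hrmin : r < min (S.u i) (S.νmax i) := by
    refine lt_of_pow_lt_pow_left₀ d (le_min (S.u_pos i).le νmax_nonneg) ?_
    have h2 := hK.2.trans (mul_le_mul_of_nonneg_left (min_le_right _ _) (by linarith))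
    rw [hmsub] at h2
    rw [hrd, div_lt_iff₀ (by positivity)]
    refine hqK.trans_le ?_
    rw [div_le_iff₀ (by positivity)]
    linarith
  -- This keeps the `4r`-balls where `p ≤ pmax`. It follows from `K ≤ (n-1)ρ/2` and `ρ ≤ pmax * η_d
  -- * u^d`.
  have hru : 4 * r < S.u i := by
    refine lt_of_pow_lt_pow_left₀ d (S.u_pos i).le ?_
    have h2 : S.pmax i * (unitBallVolume d * (4 * r) ^ d) <
        S.pmax i * (unitBallVolume d * S.u i ^ d) := by
      rw [hqr]
      refine hqK.trans_le (le_trans ?_ (ρ_le_pmax_mul hp))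
      rw [div_le_iff₀ (by positivity)]
      rw [hmsub] at hKρ
      nlinarith [S.ρ_pos i]
    exact lt_of_mul_lt_mul_left (lt_of_mul_lt_mul_left h2 hpm.le) hη.le
  obtain ⟨hDconn, hDcov⟩ := inner_of_lt_νmax hr0 (hrmin.trans_le (min_le_right _ _))
  obtain ⟨T, hTD, hDT, hcard⟩ := exists_separated_net (S.C_volume_ne_top i) hr0
    (fun x hx => ball_subset_C hr0 hx)
  have hball : ∀ y ∈ T, Metric.ball y r ⊆ S.C i := fun y hy => ball_subset_C hr0 (hTD y hy)
  set W₁ : Set (Fin (m + 1) → Euc d) := {X | ∃ a, X a ∈ S.C i ∧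
    (k : ℝ) ≤ (({l | l ≠ a ∧ dist (X l) (X a) < 4 * r}.ncard : ℕ) : ℝ)} with hW₁
  set W₂ : Set (Fin (m + 1) → Euc d) := ⋃ y ∈ T, {X | ∀ l, X l ∉ Metric.ball y r} with hW₂
  refine ⟨W₁ ∪ W₂, ?_, fun X hX V hV a b ha hb => ?_⟩
  · rw [withinExponent_eq, two_mul]
    refine (measureReal_union_le _ _).trans (add_le_add ?_ ?_)
    · refine (measureReal_pi_exists_le_ncard_ball (densityMeasure p) (q := q) (fun x hx => ?_)
        m k).trans ?_
      · exact (measureReal_ball_le hp hx (by positivity) hru.le).trans_eq hqr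
      · have h2 := mul_exp_neg_le_of_log_le hn2 (withinRate_le (S := S) (i := i) hd hp) hlf hK16 hkK
        have h3 : (m : ℝ) * q = ((k : ℝ) - 1) / 2 := by rw [hq]; field_simp
        rw [h3]
        push_cast at h2
        exact h2
    · refine (measureReal_biUnion_finset_le _ _).trans ?_
      have hone : ∀ y ∈ T, (sampleLaw p (m + 1)).real {X | ∀ l, X l ∉ Metric.ball y r} ≤
          Real.exp (-(((m + 1 : ℕ) : ℝ) * (2 * (1 / 4 ^ (d + 1) * (S.t / S.pmax i)) *
            (((k : ℝ) - 1) / (((m + 1 : ℕ) : ℝ) - 1))))) := by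
        intro y hy
        refine (measureReal_pi_forall_notMem_le (densityMeasure p)
          Metric.isOpen_ball.measurableSet (hp.le_measureReal Metric.isOpen_ball.measurableSet
            measure_ball_lt_top.ne ht.le (hae.mono fun x hx hxy =>
              hx (S.C_subset i (hball y hy hxy)))) (m + 1)).trans_eq ?_
        rw [volumeReal_ball _ hr0, hrd, hq, hmsub]
        congr 3
        field_simp
        ring
      refine (Finset.sum_le_sum hone).trans ?_
      rw [Finset.sum_const, nsmul_eq_mul]
      refine mul_exp_neg_le_of_mul_le hn2 (logFactor_pos hp hβ) (withinRate_pos hp)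
        (withinRate_le hd hp) hlf hK16 (hK.log_le hp hβ hn) hkK ?_
      rw [hmsub, logFactor]
      -- Packing with radius `r/2` turns `4^d` into `8^d`: the net has at most `logFactor *
      -- (n-1)/(k-1)` balls, which explains the constant in the logarithm of Condition 1.
      have h8 : unitBallVolume d * (r / 2) ^ d = ((k : ℝ) - 1) / (2 * m * S.pmax i * 8 ^ d) := by
        rw [div_pow, hrd, hq, show (8 : ℝ) ^ d = 4 ^ d * 2 ^ d by rw [← mul_pow]; norm_num]
        field_simp
      rw [h8, mul_div_assoc', div_le_iff₀ (by positivity)] at hcard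
      linarith
  · rw [Set.mem_union, not_or] at hX
    have hfew : ∀ c, X c ∈ S.C i → {l | l ≠ c ∧ dist (X l) (X c) < 4 * r}.ncard < k := by
      intro c hc
      by_contra! hcon
      exact hX.1 ⟨c, hc, by exact_mod_cast hcon⟩
    have hex : ∀ y ∈ T, ∃ c, dist (X c) y < r := by
      intro y hy
      by_contra! hcon
      refine hX.2 (Set.mem_biUnion hy fun l hl => ?_)
      exact absurd (Metric.mem_ball.1 hl) (not_lt.2 (hcon l))
    refine reachable_of_net (C := S.C i) (X := fun c : V => X c) hDconn hTD hball hr0 hDT hDcov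
      ?_ ?_ ha hb
    · intro a b hab ha hb hlt
      exact mutualKNN_adj_of_dist_lt (fun h => hab (Subtype.ext h)) hlt (hfew _ ha) (hfew _ hb)
    · intro y hy
      obtain ⟨c, hc⟩ := hex y hy
      exact ⟨⟨c, hV c (hball y hy hc)⟩, hc⟩

end ClusterModel

/-! ### Kernel density estimation -/

theorem IsBoundedDensity.isProbabilityMeasure_sampleLaw {d : ℕ} {p : Euc d → ℝ}
    (hp : IsBoundedDensity p) (n : ℕ) : IsProbabilityMeasure (sampleLaw p n) := by
  have := hp.isProbabilityMeasure
  unfold sampleLaw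
  infer_instance

/-- The convolution of the density with the rescaled kernel. -/
noncomputable def smoothedDensity {d : ℕ} (p K : Euc d → ℝ) (h : ℝ) (x : Euc d) : ℝ :=
  ∫ v, K v * p (x - h • v)

/-- The derivative is `B`-Lipschitz, so the mean value inequality on the ball of radius `‖w‖`
applies; the sharp factor `1/2` is not needed. -/
theorem taylor_bound {E : Type*} [NormedAddCommGroup E] [NormedSpace ℝ E] {p : E → ℝ}
    (hp : ContDiff ℝ 2 p) {B : ℝ} (hB : ∀ x, ‖iteratedFDeriv ℝ 2 p x‖ ≤ B) (x w : E) :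
    |p (x + w) - p x - fderiv ℝ p x w| ≤ B * ‖w‖ ^ 2 := by
  have hB0 : 0 ≤ B := (norm_nonneg _).trans (hB x)
  have hd : Differentiable ℝ p := hp.differentiable (by norm_num)
  have hd2 : Differentiable ℝ (fderiv ℝ p) :=
    (hp.fderiv_right (m := 1) (by norm_num)).differentiable (by norm_num)
  have hlip : ∀ y, ‖fderiv ℝ p y - fderiv ℝ p x‖ ≤ B * ‖y - x‖ := fun y =>
    Convex.norm_image_sub_le_of_norm_fderiv_le (𝕜 := ℝ) (s := Set.univ) (fun z _ => hd2 z)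
      (fun z _ => by
        rw [← norm_iteratedFDeriv_one, norm_iteratedFDeriv_fderiv]
        exact hB z) convex_univ (Set.mem_univ _) (Set.mem_univ _)
  have h := Convex.norm_image_sub_le_of_norm_hasFDerivWithin_le' (𝕜 := ℝ) (f := p)
    (s := Metric.closedBall x ‖w‖) (φ := fderiv ℝ p x) (C := B * ‖w‖)
    (fun y _ => (hd y).hasFDerivAt.hasFDerivWithinAt)
    (fun y hy => (hlip y).trans (mul_le_mul_of_nonneg_left (by
      rwa [mem_closedBall_iff_norm] at hy) hB0)) (convex_closedBall x ‖w‖)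
    (Metric.mem_closedBall_self (norm_nonneg w)) (y := x + w) (by simp)
  rw [add_sub_cancel_left, Real.norm_eq_abs] at h
  exact h.trans_eq (by ring)

namespace IsKernel

variable {d : ℕ} {K : Euc d → ℝ}

theorem integrable (hK : IsKernel K) : Integrable K := by
  by_contra h
  have := hK.integral_one
  rw [integral_undef h] at this
  exact zero_ne_one this

theorem integrable_clm_mul (hK : IsKernel K) (L : Euc d →L[ℝ] ℝ) :
    Integrable fun v => K v * L v := by
  refine Integrable.mono' ((hK.integrable.add hK.second_moment).const_mul ‖L‖)
    (hK.measurable.mul L.continuous.measurable).aestronglyMeasurable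
    (Filter.Eventually.of_forall fun v => ?_)
  have h1 := hK.nonneg v
  have h2 := L.le_opNorm v
  rw [norm_mul, Real.norm_of_nonneg h1]
  have h3 : ‖v‖ ≤ 1 + ‖v‖ ^ 2 := by nlinarith [sq_nonneg (‖v‖ - 1), norm_nonneg v]
  calc K v * ‖L v‖ ≤ K v * (‖L‖ * (1 + ‖v‖ ^ 2)) :=
        mul_le_mul_of_nonneg_left (h2.trans (mul_le_mul_of_nonneg_left h3 (norm_nonneg _))) h1
    _ = ‖L‖ * (K v + ‖v‖ ^ 2 * K v) := by ring

/-- The integrand is odd. This removes the first-order term of the bias. -/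
theorem integral_clm_mul (hK : IsKernel K) (L : Euc d →L[ℝ] ℝ) : ∫ v, K v * L v = 0 := by
  have h := integral_neg_eq_self (fun v => K v * L v) volume
  simp only [hK.symmetric, map_neg, mul_neg, integral_neg] at h
  linarith

end IsKernel

section Smoothing

variable {d : ℕ} {p K : Euc d → ℝ}

theorem integrable_kernel_mul (hp : IsBoundedDensity p) (hK : IsKernel K) (h : ℝ) (x : Euc d) :
    Integrable fun v => K v * p (x - h • v) := by
  obtain ⟨B, hB⟩ := hp.bounded
  have hpm := hp.measurable
  refine hK.integrable.mul_bdd (c := B)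
    (hpm.comp (by fun_prop)).aestronglyMeasurable (Filter.Eventually.of_forall fun v => ?_)
  rw [Real.norm_of_nonneg (hp.nonneg _)]
  exact hB _

theorem smoothedDensity_le (hp : IsBoundedDensity p) (hK : IsKernel K) {B : ℝ} (hB : ∀ x, p x ≤ B)
    (h : ℝ) (x : Euc d) : smoothedDensity p K h x ≤ B := by
  have h1 : ∫ v, K v * p (x - h • v) ≤ ∫ v, K v * B :=
    integral_mono (integrable_kernel_mul hp hK h x) (hK.integrable.mul_const B)
      fun v => mul_le_mul_of_nonneg_left (hB _) (hK.nonneg v)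
  rwa [integral_mul_const, hK.integral_one, one_mul] at h1

/-- The bias of the kernel density estimator is of second order. -/
theorem abs_smoothedDensity_sub_le (hp : IsBoundedDensity p) (hK : IsKernel K)
    (hp2 : ContDiff ℝ 2 p) {B : ℝ} (hB : ∀ x, ‖iteratedFDeriv ℝ 2 p x‖ ≤ B) (h : ℝ) (x : Euc d) :
    |smoothedDensity p K h x - p x| ≤ B * (∫ v, ‖v‖ ^ 2 * K v) * h ^ 2 := by
  have h1 := integrable_kernel_mul hp hK h x
  have h2 := hK.integrable.mul_const (p x)
  have h3 := (hK.integrable_clm_mul (fderiv ℝ p x)).mul_const h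
  have heq : smoothedDensity p K h x - p x =
      ∫ v, (K v * p (x - h • v) - K v * p x + K v * fderiv ℝ p x v * h) := by
    rw [integral_add (f := fun v => K v * p (x - h • v) - K v * p x) (h1.sub h2) h3, integral_sub h1 h2, integral_mul_const, integral_mul_const,
      hK.integral_one, hK.integral_clm_mul, smoothedDensity]
    ring
  rw [heq, ← Real.norm_eq_abs]
  have hbd : ∀ v, ‖K v * p (x - h • v) - K v * p x + K v * fderiv ℝ p x v * h‖ ≤
      B * h ^ 2 * (‖v‖ ^ 2 * K v) := by
    intro v
    have ht := taylor_bound hp2 hB x (-(h • v))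
    rw [← sub_eq_add_neg, map_neg, map_smul, norm_neg, norm_smul, smul_eq_mul, mul_pow,
      Real.norm_eq_abs, sq_abs] at ht
    have : K v * p (x - h • v) - K v * p x + K v * fderiv ℝ p x v * h =
        K v * (p (x - h • v) - p x - -(h * fderiv ℝ p x v)) := by ring
    rw [this, norm_mul, Real.norm_of_nonneg (hK.nonneg v), Real.norm_eq_abs]
    exact (mul_le_mul_of_nonneg_left ht (hK.nonneg v)).trans_eq (by ring)
  refine (norm_integral_le_of_norm_le (hK.second_moment.const_mul _)
    (Filter.Eventually.of_forall hbd)).trans_eq ?_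
  rw [integral_const_mul]
  ring

theorem integral_kernel_densityMeasure (hp : IsBoundedDensity p) {h : ℝ} (hh : 0 < h)
    (x : Euc d) :
    ∫ y, K (h⁻¹ • (x - y)) ∂(densityMeasure p) = h ^ d * smoothedDensity p K h x := by
  rw [densityMeasure, integral_withDensity_eq_integral_toReal_smul hp.measurable.ennreal_ofReal
    (Filter.Eventually.of_forall fun _ => ENNReal.ofReal_lt_top)]
  simp only [ENNReal.toReal_ofReal (hp.nonneg _), smul_eq_mul]
  rw [← integral_sub_left_eq_self _ volume x, smoothedDensity]
  have h1 := Measure.integral_comp_inv_smul_of_nonneg volume (fun v => K v * p (x - h • v)) hh.le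
  rw [finrank_euclideanSpace_fin, smul_eq_mul] at h1
  rw [← h1]
  refine integral_congr_ae (Filter.Eventually.of_forall fun z => ?_)
  simp only [sub_sub_cancel, smul_inv_smul₀ hh.ne']
  ring

/-- The exponential moments of the summands of the kernel density estimator. -/
theorem lintegral_exp_kernel_le (hp : IsBoundedDensity p) (hK : IsKernel K) {M : ℝ}
    (hM : ∀ x, K x ≤ M) {h : ℝ} (hh : 0 < h) {l : ℝ} (hl : |l| * M ≤ 1) (x : Euc d) :
    ∫⁻ y, ENNReal.ofReal (Real.exp (l * K (h⁻¹ • (x - y)))) ∂(densityMeasure p) ≤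
      ENNReal.ofReal (Real.exp ((l + l ^ 2 * M) * (h ^ d * smoothedDensity p K h x))) := by
  have := hp.isProbabilityMeasure
  have hKm : Measurable fun y => K (h⁻¹ • (x - y)) := hK.measurable.comp (by fun_prop)
  have hint : Integrable (fun y => K (h⁻¹ • (x - y))) (densityMeasure p) :=
    Integrable.of_bound hKm.aestronglyMeasurable M (Filter.Eventually.of_forall fun y => by
      rw [Real.norm_of_nonneg (hK.nonneg _)]; exact hM _)
  have hexp : ∀ y, Real.exp (l * K (h⁻¹ • (x - y))) ≤
      1 + (l + l ^ 2 * M) * K (h⁻¹ • (x - y)) := by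
    intro y
    set Y := K (h⁻¹ • (x - y)) with hY
    have hY0 : 0 ≤ Y := hK.nonneg _
    have hYM : Y ≤ M := hM _
    have habs : |l * Y| ≤ 1 := by
      rw [abs_mul, abs_of_nonneg hY0]
      exact (mul_le_mul_of_nonneg_left hYM (abs_nonneg l)).trans hl
    -- `exp z ≤ 1 + z + z²` for `|z| ≤ 1`; then `Y² ≤ M Y` bounds the second moment by the mean, so
    -- the variance is of order `h^d`.
    have h1 := (abs_le.1 (Real.abs_exp_sub_one_sub_id_le habs)).2
    have h2 : l ^ 2 * (Y * Y) ≤ l ^ 2 * (M * Y) :=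
      mul_le_mul_of_nonneg_left (mul_le_mul_of_nonneg_right hYM hY0) (sq_nonneg l)
    nlinarith
  calc ∫⁻ y, ENNReal.ofReal (Real.exp (l * K (h⁻¹ • (x - y)))) ∂(densityMeasure p)
      ≤ ∫⁻ y, ENNReal.ofReal (1 + (l + l ^ 2 * M) * K (h⁻¹ • (x - y))) ∂(densityMeasure p) :=
        lintegral_mono fun y => ENNReal.ofReal_le_ofReal (hexp y)
    _ = ENNReal.ofReal (∫ y, (1 + (l + l ^ 2 * M) * K (h⁻¹ • (x - y))) ∂(densityMeasure p)) :=
        (ofReal_integral_eq_lintegral_ofReal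
          ((integrable_const 1).add (hint.const_mul _))
          (Filter.Eventually.of_forall fun y => (Real.exp_nonneg _).trans (hexp y))).symm
    _ ≤ _ := by
        refine ENNReal.ofReal_le_ofReal ?_
        rw [integral_add (integrable_const 1) (hint.const_mul _), integral_const_mul,
          integral_kernel_densityMeasure hp hh]
        simp only [integral_const, probReal_univ, smul_eq_mul, mul_one]
        rw [add_comm]
        exact Real.add_one_le_exp _

/-! ### Deviations of the estimator at the sample points -/

theorem kernelEstimator_nonneg (hK : IsKernel K) {h : ℝ} (hh : 0 < h) {n : ℕ} (X : Fin n → Euc d)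
    (y : Euc d) : 0 ≤ kernelEstimator K h X y := by
  unfold kernelEstimator
  exact mul_nonneg (by positivity) (Finset.sum_nonneg fun _ _ => hK.nonneg _)

/-- The estimator at a sample point uses that point too. Splitting off its own term `K 0` leaves a
sum that is i.i.d. given `X a`. -/
theorem kernelEstimator_succAbove {m : ℕ} {h : ℝ} (hh : 0 < h) (X : Fin (m + 1) → Euc d)
    (a : Fin (m + 1)) :
    ((m : ℝ) + 1) * h ^ d * kernelEstimator K h X (X a) =
      K 0 + ∑ l, K (h⁻¹ • (X a - X (a.succAbove l))) := by
  unfold kernelEstimator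
  rw [Fin.sum_univ_succAbove _ a, sub_self, smul_zero]
  push_cast
  field_simp

theorem measureReal_le_kernelEstimator_le (hp : IsBoundedDensity p) (hK : IsKernel K) {M B : ℝ}
    (hM : ∀ x, K x ≤ M) (hM0 : 0 < M) (hB : ∀ x, p x ≤ B) (hB0 : 0 < B)
    {h : ℝ} (hh : 0 < h) {s ε : ℝ} (hε : 0 < ε) (hεB : ε ≤ B) (hs : 0 ≤ s)
    (hbias : ∀ x, |smoothedDensity p K h x - p x| ≤ ε / 2) (m : ℕ) :
    (sampleLaw p (m + 1)).real {X | ∃ a, p (X a) ≤ s - 2 * ε ∧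
      s - ε ≤ kernelEstimator K h X (X a)} ≤
      (m + 1) * Real.exp (ε / (4 * M * B) * (M + 2 * h ^ d * ε) -
        ((m : ℝ) + 1) * (h ^ d * ε ^ 2 / (16 * M * B))) := by
  have := hp.isProbabilityMeasure
  have := hp.isProbabilityMeasure_sampleLaw (m + 1)
  -- After the bias a deviation `ε/2` remains; this `l` minimizes `-l ε/2 + l² M B`, with value
  -- `-ε²/(16 M B)`. The own term `K 0 ≤ M` and the passage from `m` to `m + 1` cost only a factor
  -- not growing with the sample size.
  set l : ℝ := ε / (4 * M * B) with hl
  have hl0 : 0 < l := by positivity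
  have hlM : |l| * M ≤ 1 := by
    rw [abs_of_pos hl0, hl, div_mul_eq_mul_div, div_le_one (by positivity)]
    nlinarith [mul_pos hM0 hB0]
  have hφ : Measurable (Function.uncurry fun x y : Euc d => l * K (h⁻¹ • (x - y))) :=
    measurable_const.mul (hK.measurable.comp (by fun_prop))
  have hhd : 0 < h ^ d := pow_pos hh d
  have hmain := measureReal_pi_exists_le_exp (densityMeasure p) hφ
    (A := {x | p x ≤ s - 2 * ε}) (s := l * h ^ d * (s - 3 / 2 * ε) + l ^ 2 * M * h ^ d * B)
    (fun x hx => (lintegral_exp_kernel_le hp hK hM hh hlM x).trans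
      (ENNReal.ofReal_le_ofReal (Real.exp_le_exp.2 (by
        have h1 := (abs_le.1 (hbias x)).2
        have h2 : smoothedDensity p K h x ≤ s - 3 / 2 * ε := by
          rw [Set.mem_ofPred_eq] at hx; linarith
        have h3 := smoothedDensity_le hp hK hB h x
        have h4 := mul_le_mul_of_nonneg_left h2 (mul_pos hl0 hhd).le
        have h5 := mul_le_mul_of_nonneg_left h3
          (show 0 ≤ l ^ 2 * M * h ^ d by positivity)
        linarith)))) m (l * (((m : ℝ) + 1) * h ^ d * (s - ε) - M))
  refine (measureReal_mono ?_).trans (hmain.trans ?_)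
  · rintro X ⟨a, ha, hX⟩
    refine ⟨a, ha, ?_⟩
    rw [← Finset.mul_sum]
    refine mul_le_mul_of_nonneg_left ?_ hl0.le
    have h1 := kernelEstimator_succAbove (K := K) hh X a
    have h2 := mul_le_mul_of_nonneg_left hX (show 0 ≤ ((m : ℝ) + 1) * h ^ d by positivity)
    linarith [hM 0]
  · refine mul_le_mul_of_nonneg_left (Real.exp_le_exp.2 ?_) (by positivity)
    have h1 : l ^ 2 * M * h ^ d * B = h ^ d * ε ^ 2 / (16 * M * B) := by
      rw [hl]; field_simp; ring
    have h2 : l * h ^ d * (ε / 2) = 2 * (h ^ d * ε ^ 2 / (16 * M * B)) := by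
      rw [hl]; field_simp; ring
    have h2m : (m : ℝ) * (l * h ^ d * (ε / 2)) = m * (2 * (h ^ d * ε ^ 2 / (16 * M * B))) := by
      rw [h2]
    have h3 : 0 ≤ l * h ^ d * s := by positivity
    have h4 : 0 ≤ l * h ^ d * ε := by positivity
    have h5 : 0 ≤ h ^ d * ε ^ 2 / (16 * M * B) := by positivity
    rw [h1]
    linarith

theorem measureReal_kernelEstimator_lt_le (hp : IsBoundedDensity p) (hK : IsKernel K) {M B : ℝ}
    (hM : ∀ x, K x ≤ M) (hM0 : 0 < M) (hB : ∀ x, p x ≤ B) (hB0 : 0 < B)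
    {h : ℝ} (hh : 0 < h) {s ε : ℝ} (hε : 0 < ε) (hεB : ε ≤ B)
    (hbias : ∀ x, |smoothedDensity p K h x - p x| ≤ ε / 2) (m : ℕ) :
    (sampleLaw p (m + 1)).real {X | ∃ a, s ≤ p (X a) ∧
      kernelEstimator K h X (X a) < s - ε} ≤
      (m + 1) * Real.exp (ε / (4 * M * B) * (h ^ d * s) -
        ((m : ℝ) + 1) * (h ^ d * ε ^ 2 / (16 * M * B))) := by
  have := hp.isProbabilityMeasure
  have := hp.isProbabilityMeasure_sampleLaw (m + 1)
  set l : ℝ := ε / (4 * M * B) with hl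
  have hl0 : 0 < l := by positivity
  have hlM : |-l| * M ≤ 1 := by
    rw [abs_neg, abs_of_pos hl0, hl, div_mul_eq_mul_div, div_le_one (by positivity)]
    nlinarith [mul_pos hM0 hB0]
  have hφ : Measurable (Function.uncurry fun x y : Euc d => -l * K (h⁻¹ • (x - y))) :=
    measurable_const.mul (hK.measurable.comp (by fun_prop))
  have hhd : 0 < h ^ d := pow_pos hh d
  have hmain := measureReal_pi_exists_le_exp (densityMeasure p) hφ
    (A := {x | s ≤ p x}) (s := -(l * h ^ d * (s - ε / 2)) + l ^ 2 * M * h ^ d * B)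
    (fun x hx => (lintegral_exp_kernel_le hp hK hM hh hlM x).trans
      (ENNReal.ofReal_le_ofReal (Real.exp_le_exp.2 (by
        have h1 := (abs_le.1 (hbias x)).1
        have h2 : s - ε / 2 ≤ smoothedDensity p K h x := by
          rw [Set.mem_ofPred_eq] at hx; linarith
        have h3 := smoothedDensity_le hp hK hB h x
        have h4 := mul_le_mul_of_nonneg_left h2 (mul_pos hl0 hhd).le
        have h5 := mul_le_mul_of_nonneg_left h3
          (show 0 ≤ l ^ 2 * M * h ^ d by positivity)
        linarith)))) m (-(l * (((m : ℝ) + 1) * h ^ d * (s - ε))))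
  refine (measureReal_mono ?_).trans (hmain.trans ?_)
  · rintro X ⟨a, ha, hX⟩
    refine ⟨a, ha, ?_⟩
    rw [← Finset.mul_sum, neg_mul, neg_le_neg_iff]
    refine mul_le_mul_of_nonneg_left ?_ hl0.le
    have h1 := kernelEstimator_succAbove (K := K) hh X a
    have h2 := mul_le_mul_of_nonneg_left hX.le (show 0 ≤ ((m : ℝ) + 1) * h ^ d by positivity)
    linarith [hK.nonneg 0]
  · refine mul_le_mul_of_nonneg_left (Real.exp_le_exp.2 ?_) (by positivity)
    have h1 : l ^ 2 * M * h ^ d * B = h ^ d * ε ^ 2 / (16 * M * B) := by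
      rw [hl]; field_simp; ring
    have h2 : l * h ^ d * (ε / 2) = 2 * (h ^ d * ε ^ 2 / (16 * M * B)) := by
      rw [hl]; field_simp; ring
    have h2m : (m : ℝ) * (l * h ^ d * (ε / 2)) = m * (2 * (h ^ d * ε ^ 2 / (16 * M * B))) := by
      rw [h2]
    have h4 : 0 ≤ l * h ^ d * ε := by positivity
    have h5 : 0 ≤ h ^ d * ε ^ 2 / (16 * M * B) := by positivity
    rw [h1]
    linarith

end Smoothing

/-- Half of the exponent is sacrificed: `n * exp c * exp (-n w)` tends to zero. -/
theorem eventually_mul_exp_le (c : ℝ) {w : ℝ} (hw : 0 < w) :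
    ∀ᶠ n : ℕ in Filter.atTop, (n : ℝ) * Real.exp (c - n * (2 * w)) ≤ Real.exp (-(n * w)) := by
  have h1 : Filter.Tendsto (fun n : ℕ => w * n) Filter.atTop Filter.atTop :=
    tendsto_natCast_atTop_atTop.const_mul_atTop hw
  have h2 := (Real.tendsto_pow_mul_exp_neg_atTop_nhds_zero 1).comp h1
  have hpos : 0 < w / Real.exp c := by positivity
  filter_upwards [h2.eventually (ge_mem_nhds hpos)] with n hn
  simp only [Function.comp_apply, pow_one] at hn
  have h3 : Real.exp (c - n * (2 * w)) =
      Real.exp c * (Real.exp (-(w * n)) * Real.exp (-(n * w))) := by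
    rw [← Real.exp_add, ← Real.exp_add]; ring_nf
  rw [h3]
  have h4 : (n : ℝ) * (Real.exp c * Real.exp (-(w * n))) ≤ 1 := by
    rw [le_div_iff₀ (Real.exp_pos c)] at hn
    refine le_of_mul_le_mul_left ?_ hw
    linarith
  calc (n : ℝ) * (Real.exp c * (Real.exp (-(w * n)) * Real.exp (-(n * w))))
      = (n : ℝ) * (Real.exp c * Real.exp (-(w * n))) * Real.exp (-(n * w)) := by ring
    _ ≤ 1 * Real.exp (-(n * w)) := mul_le_mul_of_nonneg_right h4 (Real.exp_nonneg _)
    _ = _ := one_mul _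

/-- With high probability, thresholding the kernel density estimator at the sample points keeps all
points with density at least `s`, and only points of the `s - 2ε` level set. -/
theorem exists_density_event {d : ℕ} {p K : Euc d → ℝ} (hp : IsBoundedDensity p)
    (hps : IsSmoothDensity p) (hK : IsKernel K) :
    ∃ C₁ C₂ : ℝ, 0 < C₁ ∧ 0 < C₂ ∧ ∀ s ε h : ℝ, 0 < s → (∃ x, s ≤ p x) → 0 < ε → 0 < h →
      h ^ 2 ≤ C₁ * ε → ∀ᶠ n : ℕ in Filter.atTop, ∃ W : Set (Fin n → Euc d),
        (sampleLaw p n).real W ≤ 2 * Real.exp (-(C₂ * n * h ^ d * ε ^ 2)) ∧ ∀ X ∉ W, ∀ a,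
          (s ≤ p (X a) → s - ε ≤ kernelEstimator K h X (X a)) ∧
          (s - ε ≤ kernelEstimator K h X (X a) → X a ∈ levelSet p (s - 2 * ε)) := by
  obtain ⟨hp3, B₀, hB₀⟩ := hps
  obtain ⟨M₀, hM₀⟩ := hK.bounded
  set B := max B₀ 1 with hBdef
  set M := max M₀ 1 with hMdef
  have hB0 : 0 < B := lt_max_of_lt_right one_pos
  have hM0 : 0 < M := lt_max_of_lt_right one_pos
  have hM : ∀ x, K x ≤ M := fun x => (hM₀ x).trans (le_max_left _ _)
  have hB : ∀ x, p x ≤ B := fun x => by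
    have := hB₀ 0 (by norm_num) x
    rw [norm_iteratedFDeriv_zero] at this
    exact (le_abs_self _).trans (this.trans (le_max_left _ _))
  have hB2 : ∀ x, ‖iteratedFDeriv ℝ 2 p x‖ ≤ B := fun x =>
    (hB₀ 2 (by norm_num) x).trans (le_max_left _ _)
  set C := B * ∫ v, ‖v‖ ^ 2 * K v with hC
  have hC0 : 0 ≤ C := mul_nonneg hB0.le
    (integral_nonneg fun v => mul_nonneg (by positivity) (hK.nonneg v))
  -- `C₁` makes the bias `C h²` at most `ε/2`. `C₂` is half of the Chernoff rate `1/(16 M B)`, the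
  -- other half absorbing the union bound. Neither depends on the level.
  refine ⟨1 / (2 * (C + 1)), 1 / (32 * M * B), by positivity, by positivity, ?_⟩
  intro s ε h hs ⟨x₀, hx₀⟩ hε hh hhε
  by_cases hεB : ε ≤ B
  · have hbias : ∀ x, |smoothedDensity p K h x - p x| ≤ ε / 2 := fun x => by
      refine (abs_smoothedDensity_sub_le hp hK (hp3.of_le (by norm_num)) hB2 h x).trans ?_
      rw [div_mul_eq_mul_div, one_mul, le_div_iff₀ (by positivity)] at hhε
      nlinarith [sq_nonneg h]
    set w : ℝ := h ^ d * ε ^ 2 / (32 * M * B) with hw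
    have hw0 : 0 < w := by positivity
    filter_upwards [eventually_mul_exp_le (ε / (4 * M * B) * (M + 2 * h ^ d * ε)) hw0,
      eventually_mul_exp_le (ε / (4 * M * B) * (h ^ d * s)) hw0, Filter.eventually_ge_atTop 1]
      with n hn1 hn2 hn
    obtain ⟨m, rfl⟩ : ∃ m, n = m + 1 := ⟨n - 1, by omega⟩
    refine ⟨{X | ∃ a, p (X a) ≤ s - 2 * ε ∧ s - ε ≤ kernelEstimator K h X (X a)} ∪
      {X | ∃ a, s ≤ p (X a) ∧ kernelEstimator K h X (X a) < s - ε}, ?_, fun X hX a => ⟨?_, ?_⟩⟩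
    · have hw2 : h ^ d * ε ^ 2 / (16 * M * B) = 2 * w := by rw [hw]; field_simp; ring
      have hw3 : 1 / (32 * M * B) * ((m + 1 : ℕ) : ℝ) * h ^ d * ε ^ 2 = ((m + 1 : ℕ) : ℝ) * w := by
        rw [hw]; ring
      have h1 := measureReal_le_kernelEstimator_le hp hK hM hM0 hB hB0 hh hε hεB hs.le hbias m
      have h2 := measureReal_kernelEstimator_lt_le (s := s) hp hK hM hM0 hB hB0 hh hε hεB hbias m
      rw [hw2] at h1 h2
      push_cast at hn1 hn2
      rw [hw3, two_mul (Real.exp _)]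
      push_cast
      exact (measureReal_union_le _ _).trans (add_le_add (h1.trans hn1) (h2.trans hn2))
    · intro ha
      by_contra! hcon
      exact hX (Or.inr ⟨a, ha, hcon⟩)
    · intro ha
      by_contra hcon
      refine hX (Or.inl ⟨a, ?_, ha⟩)
      by_contra! hlt
      exact hcon (subset_closure hlt.le)
  -- For `ε` above the bound `B` of the density both thresholds are negative, so the claims are
  -- trivial and the empty event will do.
  · have hsε : s < ε := (hx₀.trans (hB x₀)).trans_lt (not_le.1 hεB)
    refine Filter.Eventually.of_forall fun n => ⟨∅, by simp; positivity, fun X _ a => ⟨?_, ?_⟩⟩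
    · intro _
      exact (by linarith : s - ε ≤ 0).trans (kernelEstimator_nonneg hK hh X _)
    · intro _
      rw [levelSet_eq_univ hp (by linarith)]
      trivial

/-! ### The optimal number of neighbors -/

namespace ClusterModel

variable {d : ℕ} {p : Euc d → ℝ} {S : ClusterModel p} {i : Fin S.m}

theorem betweenExponent_kOpt (hp : IsBoundedDensity p) {n : ℕ} (hn : 2 ≤ n) :
    S.betweenExponent i n (S.kOpt i n) = ((n : ℝ) - 1) * S.ΩnoiseFree i := by
  have hpm := pmax_pos (i := i) hp
  have ht := S.t_pos
  have hn' : (2 : ℝ) ≤ n := by exact_mod_cast hn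
  have hn1 : (n : ℝ) - 1 ≠ 0 := by linarith
  unfold betweenExponent kOpt ΩnoiseFree Γ
  rw [add_sub_cancel_right, mul_div_cancel_left₀ _ hn1]
  field_simp
  ring

theorem withinExponent_kOpt (hp : IsBoundedDensity p) (n : ℕ) :
    S.withinExponent i n (S.kOpt i n) = ((n : ℝ) - 1) * S.ΩnoiseFree i := by
  have hpm := pmax_pos (i := i) hp
  have ht := S.t_pos
  unfold withinExponent kOpt ΩnoiseFree Γ
  rw [add_sub_cancel_right]
  field_simp
  ring

theorem worstExponent_kOpt (hp : IsBoundedDensity p) {n : ℕ} (hn : 2 ≤ n) :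
    S.worstExponent i n (S.kOpt i n) = ((n : ℝ) - 1) * S.ΩnoiseFree i := by
  rw [worstExponent, betweenExponent_kOpt hp hn, withinExponent_kOpt hp, min_self]

/-- Below `kOpt` the increasing exponent is already too small, above it the decreasing one. -/
theorem worstExponent_lt (hp : IsBoundedDensity p) {n : ℕ} (hn : 2 ≤ n) {k : ℝ}
    (hk : k ≠ S.kOpt i n) :
    S.worstExponent i n k < S.worstExponent i n (S.kOpt i n) := by
  have hn' : (2 : ℝ) ≤ n := by exact_mod_cast hn
  have hn1 : 0 < (n : ℝ) - 1 := by linarith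
  rw [worstExponent_kOpt hp hn]
  rcases lt_or_gt_of_ne hk with h | h
  · refine (min_le_right _ _).trans_lt ?_
    rw [← withinExponent_kOpt hp, withinExponent_eq, withinExponent_eq]
    exact mul_lt_mul_of_pos_right (by linarith) (withinRate_pos hp)
  · refine (min_le_left _ _).trans_lt ?_
    rw [← betweenExponent_kOpt hp hn]
    unfold betweenExponent
    gcongr

theorem worstExponent_le (hp : IsBoundedDensity p) {n : ℕ} (hn : 2 ≤ n) (k : ℝ) :
    S.worstExponent i n k ≤ S.worstExponent i n (S.kOpt i n) := by
  by_cases hk : k = S.kOpt i n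
  · rw [hk]
  · exact (worstExponent_lt hp hn hk).le

theorem mul_Ωnoisy {n : ℕ} (hn : 2 ≤ n) (c δ h ε : ℝ) :
    ((n : ℝ) - 1) * S.Ωnoisy i n c δ h ε =
      min (((n : ℝ) - 1) * S.ΩnoiseFree i) (min (n * (δ / 8)) (c * n * h ^ d * ε ^ 2)) := by
  have hn' : (2 : ℝ) ≤ n := by exact_mod_cast hn
  have hn1 : 0 < (n : ℝ) - 1 := by linarith
  unfold Ωnoisy
  rw [mul_min_of_nonneg _ _ hn1.le, mul_min_of_nonneg _ _ hn1.le]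
  congr 2 <;> field_simp

theorem worstExponentNoisy_kOpt (hp : IsBoundedDensity p) {n : ℕ} (hn : 2 ≤ n) (c δ h ε : ℝ) :
    S.worstExponentNoisy i n c δ h ε (S.kOpt i n) = ((n : ℝ) - 1) * S.Ωnoisy i n c δ h ε := by
  rw [worstExponentNoisy, worstExponent_kOpt hp hn, mul_Ωnoisy hn]

theorem worstExponentNoisy_le (hp : IsBoundedDensity p) {n : ℕ} (hn : 2 ≤ n) (c δ h ε k : ℝ) :
    S.worstExponentNoisy i n c δ h ε k ≤ S.worstExponentNoisy i n c δ h ε (S.kOpt i n) :=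
  min_le_min_right _ (worstExponent_le hp hn k)

end ClusterModel

/-! ### Identification of the clusters -/

/-- Only monotonicity and subadditivity of the outer measure are used, so the identification events
need not be measurable. -/
theorem one_sub_measureReal_le {α : Type*} [MeasurableSpace α] {μ : Measure α}
    [IsProbabilityMeasure μ] {W A : Set α} (h : ∀ x ∉ W, x ∈ A) : 1 - μ.real W ≤ μ.real A := by
  have h1 : (Set.univ : Set α) ⊆ W ∪ A := fun x _ => by
    by_cases hx : x ∈ W
    · exact Or.inl hx
    · exact Or.inr (h x hx)
  have h2 := (measureReal_mono (μ := μ) h1).trans (measureReal_union_le W A)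
  rw [probReal_univ] at h2
  linarith

/-- Small components are deleted as a whole, so a path between dense vertices survives entirely once
its first vertex does. -/
theorem exists_reachable_remainingVertices {d n : ℕ} {X : Fin n → Euc d} {phat : Euc d → ℝ}
    {G : SimpleGraph (Fin n)} {s δ : ℝ} {a b : denseVertices X phat s}
    (hab : (G.induce (denseVertices X phat s)).Reachable a b)
    (ha : (a : Fin n) ∈ remainingVertices X phat G s δ) :
    ∃ hb : (b : Fin n) ∈ remainingVertices X phat G s δ,
      (G.induce (remainingVertices X phat G s δ)).Reachable ⟨a, ha⟩ ⟨b, hb⟩ := by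
  obtain ⟨w⟩ := hab
  induction w with
  | nil => exact ⟨ha, SimpleGraph.Reachable.refl _⟩
  | @cons u v w h q ih =>
    have hv : (v : Fin n) ∈ remainingVertices X phat G s δ := by
      obtain ⟨hu, hcard⟩ := ha
      refine ⟨v.2, ?_⟩
      rwa [← SimpleGraph.ConnectedComponent.sound (v := ⟨u, hu⟩) h.reachable]
    obtain ⟨hw, hr⟩ := ih hv
    refine ⟨hw, SimpleGraph.Reachable.trans (SimpleGraph.Adj.reachable ?_) hr⟩
    exact h

namespace ClusterModel

variable {d : ℕ} {p : Euc d → ℝ} {S : ClusterModel p} {i : Fin S.m}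

theorem one_sub_le_probIdentified (hd : 1 ≤ d) (hp : IsBoundedDensity p) (hS : S.NoiseFree)
    {n k : ℕ} {K : ℝ} (hn : S.LargeSample i n) (hK : S.Condition1 i n K)
    (hkK : |(k : ℝ) - K| < 1) :
    1 - (Real.exp (-S.betweenExponent i n K) + 2 * Real.exp (-S.withinExponent i n K)) ≤
      S.probIdentified i n k := by
  have := hp.isProbabilityMeasure
  have := hp.isProbabilityMeasure_sampleLaw n
  have hβ : 0 < S.β i := β_pos_of_noiseFree hp hS
  obtain ⟨W₁, hW₁, hbetween⟩ := exists_between_event hd hp hβ hn hK hkK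
  obtain ⟨W₂, hW₂, hwithin⟩ := exists_within_event hd hp hS.1 hβ hn hK hkK
  set W₃ : Set (Fin n → Euc d) := {X | ∃ a, X a ∉ levelSet p S.t} with hW₃
  have hW₃0 : (sampleLaw p n).real W₃ = 0 := by
    have h1 : W₃ = ⋃ a, (fun X : Fin n → Euc d => X a) ⁻¹' (levelSet p S.t)ᶜ := by
      ext X; simp [hW₃]
    rw [measureReal_def, h1, measure_iUnion_null, ENNReal.toReal_zero]
    intro a
    exact (measurePreserving_eval (fun _ : Fin n => densityMeasure p) a).quasiMeasurePreserving
      |>.preimage_null (measure_compl_levelSet hS)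
  have hmain : 1 - (sampleLaw p n).real (W₁ ∪ W₂ ∪ W₃) ≤ S.probIdentified i n k := by
    refine one_sub_measureReal_le fun X hX => ⟨fun a b ha hb => ?_, fun a b ha j hji hb hab => ?_⟩
    · have h1 := hwithin X (fun h => hX (Or.inl (Or.inr h))) Set.univ (fun _ _ => trivial)
        ⟨a, trivial⟩ ⟨b, trivial⟩ ha hb
      exact h1.map (SimpleGraph.Embedding.induce Set.univ).toHom
    -- All sample points lie in clusters off a null set, so an edge leaving the cluster jumps to
    -- another one and has length at least `u`.
    · obtain ⟨v, w, hvw, hv, hw⟩ := exists_adj_of_reachable hab (fun c => X c ∈ S.C i) ha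
        (S.C_disjoint hji hb)
      have hwL : X w ∈ levelSet p S.t := by
        by_contra h
        exact hX (Or.inr ⟨w, h⟩)
      obtain ⟨j', hj'⟩ := S.exists_mem_C hwL
      have hne : i ≠ j' := fun h => hw (h ▸ hj')
      have h1 := hbetween X (fun h => hX (Or.inl (Or.inl h))) v w (S.C_subset_Cminus_two i hv) hvw
      have h2 := S.u_le_dist_of_mem hne (S.C_subset_Cminus_two i hv) (S.C_subset_Cminus_two j' hj')
      rw [dist_comm] at h2
      linarith
  have h1 := measureReal_union_le (μ := sampleLaw p n) (W₁ ∪ W₂) W₃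
  have h2 := measureReal_union_le (μ := sampleLaw p n) W₁ W₂
  linarith

/-- With high probability, the cluster contains sufficiently many sample points, and there are few
background points. -/
theorem exists_count_event (hp : IsBoundedDensity p) {δ ε : ℝ} (hC : S.Condition2 i δ ε) (n : ℕ) :
    ∃ W : Set (Fin n → Euc d), (sampleLaw p n).real W ≤ 2 * Real.exp (-(n * (δ / 8))) ∧
      ∀ X ∉ W, δ * n < ({l | X l ∈ S.C i}.ncard : ℝ) ∧
        ({l | X l ∈ levelSet p (S.t - 2 * ε) \ ⋃ j, S.C j}.ncard : ℝ) < δ * n := by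
  have := hp.isProbabilityMeasure
  have := hp.isProbabilityMeasure_sampleLaw n
  have hδ := hC.δ_pos
  have hl := Real.log_two_gt_d9
  have hl' := Real.log_two_lt_d9
  have hδn : 0 ≤ δ * n := by positivity
  have hBd : MeasurableSet (levelSet p (S.t - 2 * ε) \ ⋃ j, S.C j) :=
    isClosed_closure.measurableSet.diff (MeasurableSet.iUnion S.C_measurableSet)
  have hq : (densityMeasure p).real (levelSet p (S.t - 2 * ε) \ ⋃ j, S.C j) ≤ δ / 2 := by
    refine (measureReal_mono fun x hx => ?_).trans hC.boundary_mass
    obtain ⟨j, hj⟩ := Set.mem_iUnion.1 (hC.cover hx.1)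
    exact Set.mem_iUnion.2 ⟨j, hj, fun h => hx.2 (Set.mem_iUnion.2 ⟨j, h⟩)⟩
  have h1 := measureReal_pi_ncard_le (densityMeasure p) (S.C_measurableSet i)
    hC.two_mul_δ_lt.le n (δ * n)
  have h2 := measureReal_pi_le_ncard (densityMeasure p) hBd hq n (δ * n)
  refine ⟨{X | ({l | X l ∈ S.C i}.ncard : ℝ) ≤ δ * n} ∪
    {X | δ * n ≤ ({l | X l ∈ levelSet p (S.t - 2 * ε) \ ⋃ j, S.C j}.ncard : ℝ)}, ?_,
    fun X hX => ?_⟩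
  · rw [two_mul (Real.exp _)]
    refine (measureReal_union_le _ _).trans (add_le_add (h1.trans ?_) (h2.trans ?_))
    -- The rates are `1 - log 2` for the cluster, of mass above `2δ`, and `log 2 - 1/2` for the
    -- background, of mass at most `δ/2`; both exceed `1/8`.
    · refine Real.exp_le_exp.2 ?_
      nlinarith
    · refine Real.exp_le_exp.2 ?_
      nlinarith
  · rw [Set.mem_union, not_or] at hX
    exact ⟨not_le.1 hX.1, not_le.1 hX.2⟩

theorem levelSet_eq_of_continuous (hc : Continuous p) (s : ℝ) : levelSet p s = {x | s ≤ p x} :=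
  (isClosed_le continuous_const hc).closure_eq

theorem one_sub_le_probRoughlyIdentified (hd : 1 ≤ d) (hp : IsBoundedDensity p)
    (hcont : Continuous p) {δ ε : ℝ} (hC : S.Condition2 i δ ε) {Ker : Euc d → ℝ} {h : ℝ}
    {n k : ℕ} {K : ℝ} (hn : S.LargeSample i n) (hK : S.Condition1 i n K)
    (hkK : |(k : ℝ) - K| < 1) {W₀ : Set (Fin n → Euc d)}
    (hW₀ : ∀ X ∉ W₀, ∀ a, (S.t ≤ p (X a) → S.t - ε ≤ kernelEstimator Ker h X (X a)) ∧
      (S.t - ε ≤ kernelEstimator Ker h X (X a) → X a ∈ levelSet p (S.t - 2 * ε))) :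
    1 - (Real.exp (-S.betweenExponent i n K) + 2 * Real.exp (-S.withinExponent i n K) +
      2 * Real.exp (-(n * (δ / 8))) + (sampleLaw p n).real W₀) ≤
      S.probRoughlyIdentified i Ker h ε δ n k := by
  have := hp.isProbabilityMeasure_sampleLaw n
  have hβ : 0 < S.β i := by linarith [hC.two_mul_δ_lt, hC.δ_pos]
  have hL := levelSet_eq_of_continuous hcont S.t
  obtain ⟨W₁, hW₁, hbetween⟩ := exists_between_event hd hp hβ hn hK hkK
  obtain ⟨W₂, hW₂, hwithin⟩ := exists_within_event hd hp
    (Filter.Eventually.of_forall fun x hx => by rwa [hL] at hx) hβ hn hK hkK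
  obtain ⟨W₃, hW₃, hcount⟩ := exists_count_event hp hC n
  have hmain : 1 - (sampleLaw p n).real (W₁ ∪ W₂ ∪ W₃ ∪ W₀) ≤
      S.probRoughlyIdentified i Ker h ε δ n k := by
    refine one_sub_measureReal_le fun X hX => ?_
    simp only [Set.mem_union, not_or] at hX
    obtain ⟨⟨⟨hX1, hX2⟩, hX3⟩, hX0⟩ := hX
    set G := mutualKNN X k
    set D := denseVertices X (kernelEstimator Ker h X) (S.t - ε) with hD
    set V := remainingVertices X (kernelEstimator Ker h X) G (S.t - ε) δ with hV
    have hCD : ∀ a, X a ∈ S.C i → a ∈ D := fun a ha =>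
      (hW₀ X hX0 a).1 (by have := S.C_subset i ha; rwa [hL] at this)
    have hVD : ∀ a ∈ V, a ∈ D := fun a ha => ha.1
    have hDL : ∀ a ∈ D, X a ∈ levelSet p (S.t - 2 * ε) := fun a ha => (hW₀ X hX0 a).2 ha
    have hCV : ∀ a, X a ∈ S.C i → a ∈ V := by
      intro a ha
      refine ⟨hCD a ha, (hcount X hX3).1.le.trans ?_⟩
      -- The connectivity event serves every vertex set containing the cluster points. Used for `D`,
      -- it puts them all in one component, which is therefore large enough to survive; afterwards
      -- it is used again for `V`.
      have hsub : {l | X l ∈ S.C i} ⊆ Subtype.val ''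
          ((G.induce D).connectedComponentMk ⟨a, hCD a ha⟩).supp := by
        intro l hl
        refine ⟨⟨l, hCD l hl⟩, ?_, rfl⟩
        exact SimpleGraph.ConnectedComponent.sound (hwithin X hX2 D hCD ⟨l, _⟩ ⟨a, _⟩ hl ha)
      exact_mod_cast (Set.ncard_le_ncard hsub (Set.toFinite _)).trans
        (Set.ncard_image_le (Set.toFinite _))
    refine ⟨hCV, fun a b ha hb => hwithin X hX2 V hCV a b ha hb, fun a b ha j hji hb hab => ?_,
      fun a => ?_⟩
    -- Paths may run through background points, so the set to be left is `C_-^{(i)}(2ε̃)`. By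
    -- `hC.cover` the first vertex outside lies in some other `C_-^{(j')}(2ε̃)`, at distance at
    -- least `u`.
    · obtain ⟨v, w, hvw, hv, hw⟩ := exists_adj_of_reachable hab
        (fun c => X c ∈ S.Cminus i (2 * S.εtilde)) (S.C_subset_Cminus_two i ha) (fun hcon => by
          have := S.u_le_dist_of_mem hji.symm hcon (S.C_subset_Cminus_two j hb)
          rw [dist_self] at this
          linarith [S.u_pos i])
      obtain ⟨j', hj'⟩ := Set.mem_iUnion.1 (hC.cover (hDL w (hVD w w.2)))
      have hj2 : X w ∈ S.Cminus j' (2 * S.εtilde) :=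
        S.Cminus_mono j' (by linarith [hC.ε_le]) hj'
      have hne : i ≠ j' := fun h => hw (h ▸ hj2)
      have h1 := hbetween X hX1 v w hv hvw
      have h2 := S.u_le_dist_of_mem hne hv hj2
      rw [dist_comm] at h2
      linarith
    · by_contra! hcon
      obtain ⟨haD, hcard⟩ := a.2
      -- Without cluster points the component would consist of background points of `L(t-2ε)`: at
      -- least `δn` of them, but there are fewer.
      have hsub : Subtype.val '' ((G.induce D).connectedComponentMk ⟨a, haD⟩).supp ⊆
          {l | X l ∈ levelSet p (S.t - 2 * ε) \ ⋃ j, S.C j} := by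
        rintro _ ⟨c, hc, rfl⟩
        have hreach : (G.induce D).Reachable ⟨a, haD⟩ c :=
          (SimpleGraph.ConnectedComponent.exact hc).symm
        obtain ⟨hcV, hr⟩ := exists_reachable_remainingVertices hreach a.2
        refine ⟨hDL c c.2, fun hcC => ?_⟩
        obtain ⟨j, hj⟩ := Set.mem_iUnion.1 hcC
        exact hcon ⟨c, hcV⟩ hr j hj
      have h1 := Set.ncard_le_ncard hsub (Set.toFinite _)
      rw [Set.ncard_image_of_injective _ Subtype.val_injective] at h1
      have h2 : ((((G.induce D).connectedComponentMk ⟨a, haD⟩).supp.ncard : ℕ) : ℝ) ≤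
          ({l | X l ∈ levelSet p (S.t - 2 * ε) \ ⋃ j, S.C j}.ncard : ℝ) := by exact_mod_cast h1
      exact absurd (hcard.trans h2) (not_le.2 (hcount X hX3).2)
  have h0 := measureReal_union_le (μ := sampleLaw p n) (W₁ ∪ W₂ ∪ W₃) W₀
  have h1 := measureReal_union_le (μ := sampleLaw p n) (W₁ ∪ W₂) W₃
  have h2 := measureReal_union_le (μ := sampleLaw p n) W₁ W₂
  linarith

end ClusterModel

/-! ### Optimal number of neighbors and identification probabilities -/

theorem theorem1 {d : ℕ} (hd : 1 ≤ d) (p : Euc d → ℝ) (hp : IsBoundedDensity p) :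
    -- noise-free case
    (∀ (S : ClusterModel p) (i : Fin S.m),
      (∀ n : ℕ, 2 ≤ n →
        S.betweenExponent i n (S.kOpt i n) = S.withinExponent i n (S.kOpt i n) ∧
        S.worstExponent i n (S.kOpt i n) = ((n : ℝ) - 1) * S.ΩnoiseFree i ∧
        ∀ k : ℝ, k ≠ S.kOpt i n → S.worstExponent i n k < S.worstExponent i n (S.kOpt i n)) ∧
      (S.NoiseFree → ∃ n₀ : ℕ, ∀ n : ℕ, n₀ ≤ n →
        (∀ k : ℕ, S.Condition1 i n k →
          1 - (Real.exp (-S.betweenExponent i n k) + 2 * Real.exp (-S.withinExponent i n k)) ≤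
            S.probIdentified i n k) ∧
        (S.Condition1 i n (S.kOpt i n) → ∀ k : ℕ, |(k : ℝ) - S.kOpt i n| < 1 →
          1 - 3 * Real.exp (-(((n : ℝ) - 1) * S.ΩnoiseFree i)) ≤ S.probIdentified i n k))) ∧
    -- noisy case
    (IsSmoothDensity p → ∀ K : Euc d → ℝ, IsKernel K →
      ∃ C₁ C₂ : ℝ, 0 < C₁ ∧ 0 < C₂ ∧
      ∀ (S : ClusterModel p) (i : Fin S.m) (δ ε h : ℝ), S.Condition2 i δ ε → 0 < h →
        h ^ 2 ≤ C₁ * ε →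
        (∀ n : ℕ, 2 ≤ n →
          S.worstExponentNoisy i n C₂ δ h ε (S.kOpt i n) =
            ((n : ℝ) - 1) * S.Ωnoisy i n C₂ δ h ε ∧
          ∀ k : ℝ, S.worstExponentNoisy i n C₂ δ h ε k ≤
            S.worstExponentNoisy i n C₂ δ h ε (S.kOpt i n)) ∧
        ∃ n₀ : ℕ, ∀ n : ℕ, n₀ ≤ n →
          (∀ k : ℕ, S.Condition1 i n k →
            1 - (Real.exp (-S.betweenExponent i n k) + 2 * Real.exp (-S.withinExponent i n k) +
                2 * Real.exp (-(n * (δ / 8))) + 3 * Real.exp (-(C₂ * n * h ^ d * ε ^ 2))) ≤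
              S.probRoughlyIdentified i K h ε δ n k) ∧
          (S.Condition1 i n (S.kOpt i n) → ∀ k : ℕ, |(k : ℝ) - S.kOpt i n| < 1 →
            1 - 8 * Real.exp (-(((n : ℝ) - 1) * S.Ωnoisy i n C₂ δ h ε)) ≤
              S.probRoughlyIdentified i K h ε δ n k)) := by
  refine ⟨fun S i => ⟨fun n hn => ⟨?_, ClusterModel.worstExponent_kOpt hp hn,
    fun k hk => ClusterModel.worstExponent_lt hp hn hk⟩, fun hS => ?_⟩, fun hps K hK => ?_⟩
  · rw [ClusterModel.betweenExponent_kOpt hp hn, ClusterModel.withinExponent_kOpt hp]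
  · obtain ⟨n₀, hn₀⟩ := Filter.eventually_atTop.1 (S.eventually_largeSample i)
    refine ⟨n₀, fun n hn => ⟨fun k hk => ?_, fun hk k hkK => ?_⟩⟩
    · exact ClusterModel.one_sub_le_probIdentified hd hp hS (hn₀ n hn) hk (by simp)
    · have hn2 : 2 ≤ n := by exact_mod_cast (hn₀ n hn).two_le
      have h1 := ClusterModel.one_sub_le_probIdentified hd hp hS (hn₀ n hn) hk hkK
      rw [ClusterModel.betweenExponent_kOpt hp hn2, ClusterModel.withinExponent_kOpt hp] at h1
      linarith
  · obtain ⟨C₁, C₂, hC₁, hC₂, hdens⟩ := exists_density_event hp hps hK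
    refine ⟨C₁, C₂, hC₁, hC₂, fun S i δ ε h hC hh hhε => ⟨fun n hn =>
      ⟨ClusterModel.worstExponentNoisy_kOpt hp hn C₂ δ h ε,
        fun k => ClusterModel.worstExponentNoisy_le hp hn C₂ δ h ε k⟩, ?_⟩⟩
    have hcont := hps.1.continuous
    obtain ⟨x, hx⟩ := S.C_nonempty i
    have hxt := S.C_subset i hx
    rw [ClusterModel.levelSet_eq_of_continuous hcont] at hxt
    obtain ⟨n₀, hn₀⟩ := Filter.eventually_atTop.1 ((S.eventually_largeSample i).and
      (hdens S.t ε h S.t_pos ⟨x, hxt⟩ hC.ε_pos hh hhε))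
    refine ⟨n₀, fun n hn => ?_⟩
    obtain ⟨hlarge, W, hW, hWX⟩ := hn₀ n hn
    -- The density event costs only two such exponentials; nonnegativity pads this to the stated
    -- three.
    have hexp : 0 ≤ Real.exp (-(C₂ * n * h ^ d * ε ^ 2)) := Real.exp_nonneg _
    refine ⟨fun k hk => ?_, fun hk k hkK => ?_⟩
    · have h1 := ClusterModel.one_sub_le_probRoughlyIdentified hd hp hcont hC hlarge hk
        (k := k) (by simp) hWX
      linarith
    · have hn2 : 2 ≤ n := by exact_mod_cast hlarge.two_le
      have h1 := ClusterModel.one_sub_le_probRoughlyIdentified hd hp hcont hC hlarge hk hkK hWX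
      rw [ClusterModel.betweenExponent_kOpt hp hn2, ClusterModel.withinExponent_kOpt hp] at h1
      have hmin := ClusterModel.mul_Ωnoisy (S := S) (i := i) hn2 C₂ δ h ε
      have e1 : Real.exp (-(((n : ℝ) - 1) * S.ΩnoiseFree i)) ≤
          Real.exp (-(((n : ℝ) - 1) * S.Ωnoisy i n C₂ δ h ε)) :=
        Real.exp_le_exp.2 (neg_le_neg (hmin.trans_le (min_le_left _ _)))
      have e2 : Real.exp (-(n * (δ / 8))) ≤
          Real.exp (-(((n : ℝ) - 1) * S.Ωnoisy i n C₂ δ h ε)) :=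
        Real.exp_le_exp.2 (neg_le_neg (hmin.trans_le
          ((min_le_right _ _).trans (min_le_left _ _))))
      have e3 : Real.exp (-(C₂ * n * h ^ d * ε ^ 2)) ≤
          Real.exp (-(((n : ℝ) - 1) * S.Ωnoisy i n C₂ δ h ε)) :=
        Real.exp_le_exp.2 (neg_le_neg (hmin.trans_le
          ((min_le_right _ _).trans (min_le_right _ _))))
      linarith
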